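/- **Setting.** Let $\mathcal G$ be a tree on the buses $\{0,1,\dots,n\}$ with weights $B_{ik}=B_{ki}>0$ on its lines, and let $\mathbf B_i=\sum_{k\sim i}B_{ik}$. Put $v_0=1$. For $p\in\mathbb R^n$ let $s(p)=(s_{ik}(p))_{i\sim k}$ be the unique antisymmetric solution of $p_i=\sum_{k\sim i}B_{ik}s_{ik}$, $1\le i\le n$. Here $p,q$ denote the injections after the rotation that, for lines of equal conductance-to-susceptance ratio, brings the AC power flow equations into the following form. The *power flow equations* for $(p,q)\in\mathbb R^n\times\mathbb R^n$ are $$\mathbf B_iv_i-\sum_{k\sim i}B_{ik}c_{ik}=q_i\ (1\le i\le n),\qquad s_{ik}(p)^2+c_{ik}^2=v_iv_k\ (i\sim k),\qquad v_1,\dots,v_n>0,\ c_{ik}=c_{ki};$$ a pair $(v,\theta)$ with $v\in\mathbb R_{>0}^n$, $\theta\in\mathbb R^{n+1}$, $\theta_0=0$ solves them if, with $s_{ik}=\sqrt{v_iv_k}\sin(\theta_i-\theta_k)$ and $c_{ik}=\sqrt{v_iv_k}\cos(\theta_i-\theta_k)$, one has $p_i=\sum_{k\sim i}B_{ik}s_{ik}$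 and $q_i=\mathbf B_iv_i-\sum_{k\sim i}B_{ik}c_{ik}$ for $1\le i\le n$. The *reduced equations* are $$\mathbf B_iv_i-\sum_{k\sim i}B_{ik}\sqrt{v_iv_k-s_{ik}(p)^2}=q_i\quad(1\le i\le n),\qquad v_i>0,\quad v_iv_k\ge s_{ik}(p)^2,$$ and the *relaxation* is obtained by replacing "$=q_i$" by "$\le q_i$". Let $\mathcal S$ be the set of $(p,q)$ for which the relaxation is feasible. The energy function is $$E(v,\theta)=\sum_{\text{lines }ik}B_{ik}\bigl(v_i+v_k-2\sqrt{v_iv_k}\cos(\theta_i-\theta_k)\bigr)-2\sum_{i=1}^np_i\theta_i-\sum_{i=1}^nq_i\log v_i .$$ A *feeder* is a connected component of $\mathcal G$ with bus $0$ removed. **Theorem.** For every $(p,q)\in\mathcal S$ the problem of maximizing $\sum_iw_i\log v_i$ over the feasible set of the relaxation has a unique solution $v(p,q)$, the same for all weights $w_i>0$, and there is a unique $\theta(p,q)\in\mathbb R^{n+1}$ with $\theta_0=0$ and $\theta_i-\theta_k=\arcsin\bigl(s_{ik}(p)/\sqrt{v_i(p,q)\,v_k(p,q)}\bigr)$ on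 all lines. Moreover: (i) $\mathcal S$ is convex, and $(p,q)\mapsto(v(p,q),\theta(p,q))$ is continuous on $\mathcal S$. (ii) If $(p,q)\notin\mathcal S$, the power flow equations have no solution. (iii) If $(p,q)\in\mathcal S$, then $(v,\theta)=(v(p,q),\theta(p,q))$ solves the power flow equations, $v$ solves the reduced equations, and the following hold. - *High-voltage:* $v\ge v'$ componentwise for every solution $v'$ of the reduced equations, and also for every solution $(v',c')$ of the power flow equations. - *Stability:* $(v,\theta)$ lies in the domain of convexity of $E$, i.e. the Hessian of $E$ with respect to $(\log v,\theta)$ is positive semidefinite at $(v,\theta)$; explicitly, $c_{ik}=\sqrt{v_iv_k}\cos(\theta_i-\theta_k)>0$ on all lines and the $n\times n$ matrix $$M=\sum_{i=1}^n2\mathbf B_iv_i\,e_ie_i^{\mathsf T}-\sum_{\text{lines }ik}\frac{B_{ik}v_iv_k}{c_{ik}}(e_i+e_k)(e_i+e_k)^{\mathsf T}\qquad(e_0:=0)$$ is positive semidefinite. - *Voltage-regularity:* if $(p,q)$ is an interior point of $\mathcal S$, then $M$ is positive definite, $q\mapsto v(p,q)$ is differentiable at $q$, and $\partial v_i/\partial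 q_j>0$ whenever $i,j$ lie in the same feeder, while $\partial v_i/\partial q_j=0$ if they lie in different feeders. In particular $\partial v/\partial q$ is entrywise positive if bus $0$ has exactly one neighbour. It is the unique solution with these properties; indeed, if a solution $(v',\theta')$ of the power flow equations is high-voltage ($v'\ge v''$ for every solution $v''$ of the reduced equations), or is stable (the Hessian of $E$ is positive semidefinite at it), or is voltage-regular ($v'$ extends, for fixed $p$ and for injections near $q$, to a branch of solutions of the reduced equations that is differentiable at $q$ and whose Jacobian $\partial v/\partial q$ at $q$ is positive within feeders and zero between different feeders), then $v'=v(p,q)$ and $\theta'\equiv\theta(p,q)\pmod{2\pi}$. -/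

import Mathlib

/-- A radial (tree) network on the buses `0, …, n`, bus `0` being the substation. Every line
`{i, k}` carries a positive weight `B i k = B k i`; the weight is `0` on pairs that are not lines,
so that a sum over the neighbours of a bus can be written as a sum over all buses. -/
structure RadialNetwork (n : ℕ) where
  graph : SimpleGraph (Fin (n + 1))
  isTree : graph.IsTree
  B : Fin (n + 1) → Fin (n + 1) → ℝ
  B_symm : ∀ i k, B i k = B k i
  B_pos : ∀ i k, graph.Adj i k → 0 < B i k
  B_zero : ∀ i k, ¬ graph.Adj i k → B i k = 0

namespace RadialNetwork

/-- Total weight of the lines incident to bus `i`. -/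
def totalB {n : ℕ} (N : RadialNetwork n) (i : Fin (n + 1)) : ℝ := ∑ k, N.B i k

/-- Antisymmetric functions on the lines, extended by `0` to pairs that are not lines. -/
def edgeFun {n : ℕ} (N : RadialNetwork n) : Submodule ℝ (Fin (n + 1) → Fin (n + 1) → ℝ) where
  carrier := {s | (∀ i k, s k i = - s i k) ∧ ∀ i k, ¬ N.graph.Adj i k → s i k = 0}
  add_mem' := by
    rintro s t ⟨h1, h2⟩ ⟨h3, h4⟩
    refine ⟨fun i k => ?_, fun i k h => ?_⟩
    · simp only [Pi.add_apply]; rw [h1, h3]; ring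
    · simp only [Pi.add_apply]; rw [h2 i k h, h4 i k h]; ring
  zero_mem' := by simp
  smul_mem' := by
    rintro c s ⟨h1, h2⟩
    refine ⟨fun i k => ?_, fun i k h => ?_⟩
    · simp only [Pi.smul_apply, smul_eq_mul]; rw [h1]; ring
    · simp only [Pi.smul_apply, smul_eq_mul]; rw [h2 i k h]; ring

/-- `s` is a system of line flows for the active injections `p`: it lives on the lines, is
antisymmetric, and `p i = ∑ k, B i k * s i k` at every bus `i ≠ 0`. -/
def IsFlow {n : ℕ} (N : RadialNetwork n) (p : Fin n → ℝ)
    (s : Fin (n + 1) → Fin (n + 1) → ℝ) : Prop :=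
  (∀ i k, s k i = - s i k) ∧ (∀ i k, ¬ N.graph.Adj i k → s i k = 0) ∧
    ∀ i : Fin n, p i = ∑ k, N.B i.succ k * s i.succ k

/-- The map `s ↦ (∑ k, B i k * s i k)` over the buses `i ≠ 0`. -/
def divMap {n : ℕ} (N : RadialNetwork n) : N.edgeFun →ₗ[ℝ] (Fin n → ℝ) where
  toFun s i := ∑ k, N.B i.succ k * s.1 i.succ k
  map_add' s t := by
    funext i
    simp [mul_add, Finset.sum_add_distrib]
  map_smul' c s := by
    funext i
    simp only [Submodule.coe_smul, Pi.smul_apply, smul_eq_mul, RingHom.id_apply, Finset.mul_sum]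
    exact Finset.sum_congr rfl fun k _ => by ring

open Classical in
/-- Differences along lines of a potential that vanishes at bus `0`. -/
noncomputable def gradMap {n : ℕ} (N : RadialNetwork n) : (Fin n → ℝ) →ₗ[ℝ] N.edgeFun where
  toFun b := ⟨fun i k => if N.graph.Adj i k then
      (Fin.cons 0 b : Fin (n + 1) → ℝ) i - (Fin.cons 0 b : Fin (n + 1) → ℝ) k else 0, by
    refine ⟨fun i k => ?_, fun i k h => by simp [h]⟩
    by_cases h : N.graph.Adj i k
    · simp [h, h.symm]
    · have h' : ¬ N.graph.Adj k i := fun h' => h h'.symm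
      simp [h, h']⟩
  map_add' b b' := by
    ext i k
    have : (Fin.cons 0 (b + b') : Fin (n + 1) → ℝ) = Fin.cons 0 b + Fin.cons 0 b' := by
      funext j; refine Fin.cases ?_ (fun j => ?_) j <;> simp
    simp only [this, Submodule.coe_add, Pi.add_apply]
    split_ifs <;> ring
  map_smul' c b := by
    ext i k
    have : (Fin.cons 0 (c • b) : Fin (n + 1) → ℝ) = c • Fin.cons 0 b := by
      funext j; refine Fin.cases ?_ (fun j => ?_) j <;> simp
    simp only [this, Submodule.coe_smul, Pi.smul_apply, smul_eq_mul, RingHom.id_apply]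
    split_ifs <;> ring

theorem gradMap_injective {n : ℕ} (N : RadialNetwork n) : Function.Injective N.gradMap := by
  rw [← LinearMap.ker_eq_bot, LinearMap.ker_eq_bot']
  intro b hb
  have key : ∀ i k, N.graph.Adj i k →
      (Fin.cons 0 b : Fin (n + 1) → ℝ) i = (Fin.cons 0 b : Fin (n + 1) → ℝ) k := by
    intro i k h
    have h1 : (N.gradMap b).1 i k = 0 := by rw [hb]; rfl
    simp only [gradMap, LinearMap.coe_mk, AddHom.coe_mk, h, if_true] at h1
    linarith
  funext i
  obtain ⟨w⟩ := N.isTree.connected.preconnected i.succ 0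
  have walk : ∀ {x y : Fin (n + 1)}, N.graph.Walk x y →
      (Fin.cons 0 b : Fin (n + 1) → ℝ) x = (Fin.cons 0 b : Fin (n + 1) → ℝ) y := by
    intro x y w
    induction w with
    | nil => rfl
    | cons h _ ih => exact (key _ _ h).trans ih
  simpa using walk w

theorem edge_eq_zero {n : ℕ} (N : RadialNetwork n) (s : N.edgeFun) (hs : N.divMap s = 0)
    (a b : Fin (n + 1)) (hab : N.graph.Adj a b)
    (h0 : ¬ (N.graph.deleteEdges {s(a, b)}).Reachable b 0) : s.1 a b = 0 := by
  classical
  obtain ⟨s, h1, h2⟩ := s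
  have hbr : ¬ (N.graph.deleteEdges {s(a, b)}).Reachable a b :=
    SimpleGraph.isBridge_iff.1 (SimpleGraph.isAcyclic_iff_forall_adj_isBridge.1 N.isTree.isAcyclic hab)
  set H := N.graph.deleteEdges {s(a, b)} with hH
  let C : Finset (Fin (n + 1)) := Finset.univ.filter fun x => H.Reachable b x
  have hC : ∀ x, x ∈ C ↔ H.Reachable b x := fun x => by simp [C]
  have hdiv : ∀ x ∈ C, ∑ k, N.B x k * s x k = 0 := by
    intro x hx
    rcases Fin.eq_zero_or_eq_succ x with rfl | ⟨j, rfl⟩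
    · exact absurd ((hC _).1 hx) h0
    · exact congrFun hs j
  have hsum : ∑ x ∈ C, ∑ k, N.B x k * s x k = 0 := Finset.sum_eq_zero hdiv
  have hin : ∑ x ∈ C, ∑ k ∈ C, N.B x k * s x k = 0 := by
    have : ∑ x ∈ C, ∑ k ∈ C, N.B x k * s x k = - ∑ x ∈ C, ∑ k ∈ C, N.B x k * s x k := by
      conv_lhs => rw [Finset.sum_comm]
      rw [← Finset.sum_neg_distrib]
      refine Finset.sum_congr rfl fun x _ => ?_
      rw [← Finset.sum_neg_distrib]
      refine Finset.sum_congr rfl fun k _ => ?_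
      rw [N.B_symm k x, h1 x k]; ring
    linarith
  have hout : ∑ x ∈ C, ∑ k ∈ Cᶜ, N.B x k * s x k = N.B b a * s b a := by
    have hbC : b ∈ C := (hC b).2 (SimpleGraph.Reachable.refl b)
    have haC : a ∈ Cᶜ := by
      rw [Finset.mem_compl, hC]; exact fun h => hbr h.symm
    have hz : ∀ x ∈ C, ∀ k ∈ Cᶜ, (x ≠ b ∨ k ≠ a) → N.B x k * s x k = 0 := by
      intro x hx k hk hne
      by_cases hadj : N.graph.Adj x k
      · exfalso
        have hk' : ¬ H.Reachable b k := by rw [Finset.mem_compl, hC] at hk; exact hk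
        apply hk'
        refine ((hC x).1 hx).trans (SimpleGraph.Adj.reachable ?_)
        rw [hH, SimpleGraph.deleteEdges_adj]
        refine ⟨hadj, fun h => ?_⟩
        rw [Set.mem_singleton_iff, Sym2.eq_iff] at h
        rcases h with ⟨rfl, rfl⟩ | ⟨rfl, rfl⟩
        · exact hk' (SimpleGraph.Reachable.refl _)
        · simp at hne
      · rw [h2 x k hadj, mul_zero]
    rw [Finset.sum_eq_single_of_mem b hbC, Finset.sum_eq_single_of_mem a haC]
    · intro k hk hka; exact hz b hbC k hk (Or.inr hka)
    · intro x hx hxb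
      exact Finset.sum_eq_zero fun k hk => hz x hx k hk (Or.inl hxb)
  have hsplit : ∑ x ∈ C, ∑ k, N.B x k * s x k
      = ∑ x ∈ C, ∑ k ∈ C, N.B x k * s x k + ∑ x ∈ C, ∑ k ∈ Cᶜ, N.B x k * s x k := by
    rw [← Finset.sum_add_distrib]
    exact Finset.sum_congr rfl fun x _ => (Finset.sum_add_sum_compl C _).symm
  rw [hsum, hin, hout, zero_add] at hsplit
  have hB := N.B_pos b a hab.symm
  have hba : s b a = 0 := by
    rcases mul_eq_zero.1 hsplit.symm with h | h
    · exact absurd h hB.ne'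
    · exact h
  change s a b = 0
  rw [h1 b a, hba, neg_zero]

theorem divMap_injective {n : ℕ} (N : RadialNetwork n) : Function.Injective N.divMap := by
  rw [← LinearMap.ker_eq_bot, LinearMap.ker_eq_bot']
  intro s hs
  ext a b
  change s.1 a b = 0
  by_cases hab : N.graph.Adj a b
  · by_cases h0 : (N.graph.deleteEdges {s(a, b)}).Reachable b 0
    · have hbr : ¬ (N.graph.deleteEdges {s(a, b)}).Reachable a b :=
        SimpleGraph.isBridge_iff.1
          (SimpleGraph.isAcyclic_iff_forall_adj_isBridge.1 N.isTree.isAcyclic hab)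
      have h := N.edge_eq_zero s hs b a hab.symm (by
        rw [Sym2.eq_swap]; exact fun h => hbr (h.trans h0.symm))
      rw [s.2.1 b a, h, neg_zero]
    · exact N.edge_eq_zero s hs a b hab h0
  · exact s.2.2 a b hab

theorem finrank_edgeFun {n : ℕ} (N : RadialNetwork n) : Module.finrank ℝ N.edgeFun = n := by
  apply le_antisymm
  · simpa using LinearMap.finrank_le_finrank_of_injective N.divMap_injective
  · simpa using LinearMap.finrank_le_finrank_of_injective N.gradMap_injective

theorem divMap_surjective {n : ℕ} (N : RadialNetwork n) : Function.Surjective N.divMap :=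
  (LinearMap.injective_iff_surjective_of_finrank_eq_finrank
    (by simp [N.finrank_edgeFun])).1 N.divMap_injective

theorem gradMap_surjective {n : ℕ} (N : RadialNetwork n) : Function.Surjective N.gradMap :=
  (LinearMap.injective_iff_surjective_of_finrank_eq_finrank
    (by simp [N.finrank_edgeFun])).1 N.gradMap_injective

/-- The linear system for the line flows has exactly one solution. -/
theorem existsUnique_flow {n : ℕ} (N : RadialNetwork n) (p : Fin n → ℝ) :
    ∃! s, N.IsFlow p s := by
  obtain ⟨s, hs⟩ := N.divMap_surjective p
  refine ⟨s.1, ⟨s.2.1, s.2.2, fun i => (congrFun hs i).symm⟩, fun t ht => ?_⟩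
  have : (⟨t, ht.1, ht.2.1⟩ : N.edgeFun) = s := by
    apply N.divMap_injective
    rw [hs]
    funext i
    exact (ht.2.2 i).symm
  exact congrArg Subtype.val this

/-- The line flows `s(p)`. -/
noncomputable def flow {n : ℕ} (N : RadialNetwork n) (p : Fin n → ℝ) :
    Fin (n + 1) → Fin (n + 1) → ℝ :=
  (N.existsUnique_flow p).choose

theorem isFlow_flow {n : ℕ} (N : RadialNetwork n) (p : Fin n → ℝ) : N.IsFlow p (N.flow p) :=
  (N.existsUnique_flow p).choose_spec.1

/-- The squared voltage magnitudes at all buses: `1` at bus `0` and `v` at the other buses. -/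
def volt {n : ℕ} (v : Fin n → ℝ) : Fin (n + 1) → ℝ := Fin.cons 1 v

/-- `s i k = √(v i * v k) * sin (θ i - θ k)`. -/
noncomputable def sVar {n : ℕ} (v : Fin n → ℝ) (θ : Fin (n + 1) → ℝ) (i k : Fin (n + 1)) : ℝ :=
  √(volt v i * volt v k) * Real.sin (θ i - θ k)

/-- `c i k = √(v i * v k) * cos (θ i - θ k)`. -/
noncomputable def cVar {n : ℕ} (v : Fin n → ℝ) (θ : Fin (n + 1) → ℝ) (i k : Fin (n + 1)) : ℝ :=
  √(volt v i * volt v k) * Real.cos (θ i - θ k)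

/-- `(v, θ)` solves the power flow equations, in polar form. -/
structure IsPolarSolution {n : ℕ} (N : RadialNetwork n) (p q v : Fin n → ℝ)
    (θ : Fin (n + 1) → ℝ) : Prop where
  pos : ∀ i, 0 < v i
  ref : θ 0 = 0
  active : ∀ i : Fin n, p i = ∑ k, N.B i.succ k * sVar v θ i.succ k
  reactive : ∀ i : Fin n,
    q i = N.totalB i.succ * v i - ∑ k, N.B i.succ k * cVar v θ i.succ k

/-- `(v, c)` solves the power flow equations in which the flows `s(p)` have been eliminated. -/
structure IsSolution {n : ℕ} (N : RadialNetwork n) (p q v : Fin n → ℝ)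
    (c : Fin (n + 1) → Fin (n + 1) → ℝ) : Prop where
  pos : ∀ i, 0 < v i
  symm : ∀ i k, c i k = c k i
  reactive : ∀ i : Fin n, N.totalB i.succ * v i - ∑ k, N.B i.succ k * c i.succ k = q i
  consistent : ∀ i k, N.graph.Adj i k → N.flow p i k ^ 2 + c i k ^ 2 = volt v i * volt v k

/-- The reactive injection at bus `i` determined by `v` when all `c i k` are nonnegative. -/
noncomputable def reducedInjection {n : ℕ} (N : RadialNetwork n) (p v : Fin n → ℝ) (i : Fin n) :
    ℝ :=
  N.totalB i.succ * v i -
    ∑ k, N.B i.succ k * √(volt v i.succ * volt v k - N.flow p i.succ k ^ 2)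

/-- `v` is positive and the square roots in the reduced equations are real. -/
structure IsAdmissible {n : ℕ} (N : RadialNetwork n) (p v : Fin n → ℝ) : Prop where
  pos : ∀ i, 0 < v i
  sq_le : ∀ i k, N.graph.Adj i k → N.flow p i k ^ 2 ≤ volt v i * volt v k

/-- `v` is feasible for the convex relaxation. -/
def IsFeasible {n : ℕ} (N : RadialNetwork n) (p q v : Fin n → ℝ) : Prop :=
  N.IsAdmissible p v ∧ ∀ i, N.reducedInjection p v i ≤ q i

/-- `v` solves the reduced power flow equations. -/
def IsReducedSolution {n : ℕ} (N : RadialNetwork n) (p q v : Fin n → ℝ) : Prop :=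
  N.IsAdmissible p v ∧ ∀ i, N.reducedInjection p v i = q i

/-- The set of injections `(p, q)` for which the relaxation is feasible. -/
def feasibleInjections {n : ℕ} (N : RadialNetwork n) : Set ((Fin n → ℝ) × (Fin n → ℝ)) :=
  {x | ∃ v, N.IsFeasible x.1 x.2 v}

/-- `v` maximizes `∑ i, w i * log (v i)` over the feasible set of the relaxation. -/
def IsOptimal {n : ℕ} (N : RadialNetwork n) (w p q v : Fin n → ℝ) : Prop :=
  N.IsFeasible p q v ∧
    ∀ u, N.IsFeasible p q u → ∑ i, w i * Real.log (u i) ≤ ∑ i, w i * Real.log (v i)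

/-- `θ` is the system of phases recovered from the voltages `v` and the flows `s(p)`. -/
def IsPhaseOf {n : ℕ} (N : RadialNetwork n) (p v : Fin n → ℝ) (θ : Fin (n + 1) → ℝ) : Prop :=
  θ 0 = 0 ∧ ∀ i k, N.graph.Adj i k →
    θ i - θ k = Real.arcsin (N.flow p i k / √(volt v i * volt v k))

/-- `v` dominates every solution of the reduced power flow equations. -/
def IsHighVoltage {n : ℕ} (N : RadialNetwork n) (p q v : Fin n → ℝ) : Prop :=
  ∀ v', N.IsReducedSolution p q v' → v' ≤ v

/-- The energy function. Each line occurs twice in the double sum. -/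
noncomputable def energy {n : ℕ} (N : RadialNetwork n) (p q v : Fin n → ℝ)
    (θ : Fin (n + 1) → ℝ) : ℝ :=
  (∑ i, ∑ k, N.B i k *
      (volt v i + volt v k - 2 * √(volt v i * volt v k) * Real.cos (θ i - θ k))) / 2
    - 2 * ∑ i, p i * θ i.succ - ∑ i, q i * Real.log (v i)

/-- `(v, θ)` lies in the domain of convexity of the energy function: the Hessian of the energy with
respect to `(log v, θ)`, where `θ 0` is fixed, is positive semidefinite at `(v, θ)`. -/
def IsStable {n : ℕ} (N : RadialNetwork n) (p q v : Fin n → ℝ) (θ : Fin (n + 1) → ℝ) : Prop :=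
  ∀ a b : Fin n → ℝ, 0 ≤ iteratedDeriv 2 (fun t : ℝ =>
    N.energy p q (fun i => Real.exp (Real.log (v i) + t * a i))
      (fun i => θ i + t * (Fin.cons 0 b : Fin (n + 1) → ℝ) i)) 0

/-- The matrix `∑ i, 𝐁 i * [2 * v i]_i - ∑ (i, k), (B i k * v i * v k / c i k) * [1 1; 1 1]_{i,k}`,
where rows and columns are indexed by the buses other than `0`. -/
noncomputable def stabilityMatrix {n : ℕ} (N : RadialNetwork n) (v : Fin n → ℝ)
    (θ : Fin (n + 1) → ℝ) : Matrix (Fin n) (Fin n) ℝ :=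
  Matrix.diagonal (fun i => 2 * N.totalB i.succ * v i -
      ∑ k, N.B i.succ k * (v i * volt v k) / cVar v θ i.succ k) -
    Matrix.of fun i k => N.B i.succ k.succ * (v i * v k) / cVar v θ i.succ k.succ

/-- The buses `i` and `j` (both other than `0`) belong to the same feeder, that is, to the same
component of the network after removal of the substation. -/
def SameFeeder {n : ℕ} (N : RadialNetwork n) (i j : Fin n) : Prop :=
  (N.graph.comap Fin.succ).Reachable i j

/-- The matrix `D i j` is entrywise positive on every feeder; its entries between different feeders,
which do not interact because the voltage of bus `0` is fixed, vanish. If bus `0` has just one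
neighbour, this says that all entries are positive. -/
def IsFeederPositive {n : ℕ} (N : RadialNetwork n) (D : (Fin n → ℝ) →L[ℝ] (Fin n → ℝ)) : Prop :=
  ∀ i j, (N.SameFeeder i j → 0 < D (Pi.single j 1) i) ∧
    (¬ N.SameFeeder i j → D (Pi.single j 1) i = 0)

/-- Voltage-regularity at a solution `v` of the reduced power flow equations: near `q`, and for
fixed `p`, the solution continues to a branch of solutions that is differentiable at `q` and whose
Jacobian matrix `∂v/∂q` there is positive on every feeder. -/
def IsVoltageRegular {n : ℕ} (N : RadialNetwork n) (p q v : Fin n → ℝ) : Prop :=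
  ∃ (u : (Fin n → ℝ) → (Fin n → ℝ)) (D : (Fin n → ℝ) →L[ℝ] (Fin n → ℝ)),
    u q = v ∧ (∀ᶠ q' in nhds q, N.IsReducedSolution p q' (u q')) ∧ HasFDerivAt u D q ∧
      N.IsFeederPositive D

theorem hasDerivAt_expCos (x α d β t : ℝ) :
    HasDerivAt (fun t => Real.exp (x + t * α) * Real.cos (d + t * β))
      (Real.exp (x + t * α) * (α * Real.cos (d + t * β) - β * Real.sin (d + t * β))) t := by
  have h1 : HasDerivAt (fun t : ℝ => x + t * α) α t := by
    simpa using ((hasDerivAt_id t).mul_const α).const_add x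
  have h2 : HasDerivAt (fun t : ℝ => d + t * β) β t := by
    simpa using ((hasDerivAt_id t).mul_const β).const_add d
  exact (h1.exp.mul h2.cos).congr_deriv (by ring)

theorem hasDerivAt_expSin (x α d β t : ℝ) :
    HasDerivAt (fun t => Real.exp (x + t * α) * Real.sin (d + t * β))
      (Real.exp (x + t * α) * (α * Real.sin (d + t * β) + β * Real.cos (d + t * β))) t := by
  have h1 : HasDerivAt (fun t : ℝ => x + t * α) α t := by
    simpa using ((hasDerivAt_id t).mul_const α).const_add x
  have h2 : HasDerivAt (fun t : ℝ => d + t * β) β t := by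
    simpa using ((hasDerivAt_id t).mul_const β).const_add d
  exact (h1.exp.mul h2.sin).congr_deriv (by ring)

theorem hasDerivAt_expLin (x α t : ℝ) :
    HasDerivAt (fun t => Real.exp (x + t * α)) (α * Real.exp (x + t * α)) t := by
  have h1 : HasDerivAt (fun t : ℝ => x + t * α) α t := by
    simpa using ((hasDerivAt_id t).mul_const α).const_add x
  exact h1.exp.congr_deriv (by ring)

/-- The quadratic form of the Hessian of the energy in the coordinates `(log v, θ)`. -/
theorem energy_hessian {n : ℕ} (N : RadialNetwork n) (p q v : Fin n → ℝ) (hv : ∀ i, 0 < v i)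
    (θ : Fin (n + 1) → ℝ) (a b : Fin n → ℝ) (A D : Fin (n + 1) → ℝ)
    (hA : A = Fin.cons 0 a) (hD : D = Fin.cons 0 b) :
    iteratedDeriv 2 (fun t : ℝ =>
      N.energy p q (fun i => Real.exp (Real.log (v i) + t * a i))
        (fun i => θ i + t * (Fin.cons 0 b : Fin (n + 1) → ℝ) i)) 0 =
    (∑ i, ∑ k, N.B i k * (A i ^ 2 * volt v i + A k ^ 2 * volt v k
      - 2 * (((A i + A k) / 2) ^ 2 * cVar v θ i k - (A i + A k) * (D i - D k) * sVar v θ i k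
        - (D i - D k) ^ 2 * cVar v θ i k))) / 2 := by
  set X : Fin (n + 1) → ℝ := Fin.cons 0 (fun i => Real.log (v i)) with hX
  have hvolt : ∀ t : ℝ, volt (fun i => Real.exp (Real.log (v i) + t * a i))
      = fun i => Real.exp (X i + t * A i) := by
    intro t; funext i
    refine Fin.cases ?_ (fun i => ?_) i <;> simp [volt, hX, hA]
  have hvolt0 : ∀ i, volt v i = Real.exp (X i) := by
    intro i
    refine Fin.cases ?_ (fun i => ?_) i
    · simp [volt, hX]
    · simp [volt, hX, Real.exp_log (hv i)]
  have hsq : ∀ x y : ℝ, √(Real.exp x * Real.exp y) = Real.exp ((x + y) / 2) := by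
    intro x y
    rw [← Real.exp_add, Real.exp_half]
  have hE : (fun t : ℝ => N.energy p q (fun i => Real.exp (Real.log (v i) + t * a i))
        (fun i => θ i + t * (Fin.cons 0 b : Fin (n + 1) → ℝ) i)) = fun t =>
      (∑ i, ∑ k, N.B i k * (Real.exp (X i + t * A i) + Real.exp (X k + t * A k)
        - 2 * (Real.exp ((X i + X k) / 2 + t * ((A i + A k) / 2)) *
            Real.cos ((θ i - θ k) + t * (D i - D k))))) / 2
      - 2 * ∑ i, p i * (θ i.succ + t * b i) - ∑ i, q i * (Real.log (v i) + t * a i) := by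
    funext t
    unfold energy
    rw [hvolt]
    simp only [hsq, Real.log_exp, ← hD]
    congr 2
    · congr 1
      refine Finset.sum_congr rfl fun i _ => Finset.sum_congr rfl fun k _ => ?_
      rw [show (X i + t * A i + (X k + t * A k)) / 2 = (X i + X k) / 2 + t * ((A i + A k) / 2) by ring,
        show θ i + t * D i - (θ k + t * D k) = (θ i - θ k) + t * (D i - D k) by ring]
      ring
    · simp [hD]
  rw [hE]
  have hlin : ∀ x y z t : ℝ, HasDerivAt (fun t : ℝ => z * (x + t * y)) (z * y) t := by
    intro x y z t
    simpa using (((hasDerivAt_id t).mul_const y).const_add x).const_mul z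
  have d1 : ∀ t : ℝ, HasDerivAt (fun t =>
      (∑ i, ∑ k, N.B i k * (Real.exp (X i + t * A i) + Real.exp (X k + t * A k)
        - 2 * (Real.exp ((X i + X k) / 2 + t * ((A i + A k) / 2)) *
            Real.cos ((θ i - θ k) + t * (D i - D k))))) / 2
      - 2 * ∑ i, p i * (θ i.succ + t * b i) - ∑ i, q i * (Real.log (v i) + t * a i))
      ((∑ i, ∑ k, N.B i k * (A i * Real.exp (X i + t * A i) + A k * Real.exp (X k + t * A k)
        - 2 * (((A i + A k) / 2) * (Real.exp ((X i + X k) / 2 + t * ((A i + A k) / 2)) *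
            Real.cos ((θ i - θ k) + t * (D i - D k))) - (D i - D k) *
            (Real.exp ((X i + X k) / 2 + t * ((A i + A k) / 2)) *
            Real.sin ((θ i - θ k) + t * (D i - D k)))))) / 2
      - 2 * ∑ i, p i * b i - ∑ i, q i * a i) t := by
    intro t
    refine ((HasDerivAt.div_const (HasDerivAt.fun_sum fun i _ => HasDerivAt.fun_sum fun k _ => ?_) 2).sub
      (HasDerivAt.const_mul 2 (HasDerivAt.fun_sum fun i _ => hlin _ _ _ t))).sub
      (HasDerivAt.fun_sum fun i _ => hlin _ _ _ t)
    refine ((((hasDerivAt_expLin _ _ t).add (hasDerivAt_expLin _ _ t)).sub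
      ((hasDerivAt_expCos _ _ _ _ t).const_mul 2)).const_mul (N.B i k)).congr_deriv ?_
    ring
  have hd1 := funext fun t => (d1 t).deriv
  rw [iteratedDeriv_succ, iteratedDeriv_one, hd1]
  have d2 : HasDerivAt (fun t : ℝ =>
      ((∑ i, ∑ k, N.B i k * (A i * Real.exp (X i + t * A i) + A k * Real.exp (X k + t * A k)
        - 2 * (((A i + A k) / 2) * (Real.exp ((X i + X k) / 2 + t * ((A i + A k) / 2)) *
            Real.cos ((θ i - θ k) + t * (D i - D k))) - (D i - D k) *
            (Real.exp ((X i + X k) / 2 + t * ((A i + A k) / 2)) *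
            Real.sin ((θ i - θ k) + t * (D i - D k)))))) / 2
      - 2 * ∑ i, p i * b i - ∑ i, q i * a i))
      ((∑ i, ∑ k, N.B i k * (A i ^ 2 * volt v i + A k ^ 2 * volt v k
      - 2 * (((A i + A k) / 2) ^ 2 * cVar v θ i k - (A i + A k) * (D i - D k) * sVar v θ i k
        - (D i - D k) ^ 2 * cVar v θ i k))) / 2) 0 := by
    refine ((HasDerivAt.div_const (HasDerivAt.fun_sum fun i _ => HasDerivAt.fun_sum fun k _ => ?_) 2).sub_const
      _).sub_const _
    refine (((((hasDerivAt_expLin _ _ 0).const_mul (A i)).add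
      ((hasDerivAt_expLin _ _ 0).const_mul (A k))).sub
      ((((hasDerivAt_expCos _ _ _ _ 0).const_mul ((A i + A k) / 2)).sub
        ((hasDerivAt_expSin _ _ _ _ 0).const_mul (D i - D k))).const_mul 2)).const_mul
          (N.B i k)).congr_deriv ?_
    simp only [sVar, cVar, hvolt0, hsq, zero_mul, add_zero]
    ring
  exact d2.deriv

theorem volt_pos {n : ℕ} {v : Fin n → ℝ} (hv : ∀ i, 0 < v i) (i : Fin (n + 1)) :
    0 < volt v i := by
  refine Fin.cases ?_ (fun i => ?_) i <;> simp [volt, hv]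

theorem cVar_symm {n : ℕ} (v : Fin n → ℝ) (θ : Fin (n + 1) → ℝ) (i k : Fin (n + 1)) :
    cVar v θ i k = cVar v θ k i := by
  rw [cVar, cVar, mul_comm (volt v i), ← Real.cos_neg (θ i - θ k), neg_sub]

theorem sVar_antisymm {n : ℕ} (v : Fin n → ℝ) (θ : Fin (n + 1) → ℝ) (i k : Fin (n + 1)) :
    sVar v θ k i = - sVar v θ i k := by
  rw [sVar, sVar, mul_comm (volt v k), ← mul_neg, ← Real.sin_neg (θ i - θ k), neg_sub]

theorem sVar_sq_add_cVar_sq {n : ℕ} {v : Fin n → ℝ} (hv : ∀ i, 0 < v i) (θ : Fin (n + 1) → ℝ)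
    (i k : Fin (n + 1)) : sVar v θ i k ^ 2 + cVar v θ i k ^ 2 = volt v i * volt v k := by
  have h := Real.sq_sqrt (mul_pos (volt_pos hv i) (volt_pos hv k)).le
  have h' := Real.sin_sq_add_cos_sq (θ i - θ k)
  rw [sVar, cVar, mul_pow, mul_pow, ← mul_add, h', h, mul_one]

theorem stabilityMatrix_form {n : ℕ} (N : RadialNetwork n) (v : Fin n → ℝ) (θ : Fin (n + 1) → ℝ)
    (a : Fin n → ℝ) (A : Fin (n + 1) → ℝ) (hA : A = Fin.cons 0 a) :
    dotProduct a ((N.stabilityMatrix v θ).mulVec a) =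
      ∑ i, ∑ k, N.B i k * (A i ^ 2 * volt v i + A k ^ 2 * volt v k
        - (volt v i * volt v k / cVar v θ i k) * (A i + A k) ^ 2 / 2) := by
  have hA0 : A 0 = 0 := by simp [hA]
  have hAs : ∀ i : Fin n, A i.succ = a i := by simp [hA]
  have hvs : ∀ i : Fin n, volt v i.succ = v i := by simp [volt]
  have e1 : ∑ i, ∑ k, N.B i k * (A i ^ 2 * volt v i + A k ^ 2 * volt v k
        - (volt v i * volt v k / cVar v θ i k) * (A i + A k) ^ 2 / 2)
      = ∑ i, ∑ k, (2 * N.B i k * (A i ^ 2 * volt v i)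
        - N.B i k * (volt v i * volt v k / cVar v θ i k) * (A i ^ 2 + A i * A k)) := by
    have sw : ∀ f : Fin (n + 1) → Fin (n + 1) → ℝ,
        ∑ i, ∑ k, f i k = ∑ i, ∑ k, (f i k + f k i) / 2 := by
      intro f
      have := Finset.sum_comm (s := (Finset.univ : Finset (Fin (n + 1))))
        (t := (Finset.univ : Finset (Fin (n + 1)))) (f := f)
      simp only [← Finset.sum_div, Finset.sum_add_distrib]
      linarith
    rw [sw, sw fun i k => 2 * N.B i k * (A i ^ 2 * volt v i)
        - N.B i k * (volt v i * volt v k / cVar v θ i k) * (A i ^ 2 + A i * A k)]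
    refine Finset.sum_congr rfl fun i _ => Finset.sum_congr rfl fun k _ => ?_
    rw [N.B_symm k i, cVar_symm v θ k i]
    ring
  rw [e1]
  rw [Fin.sum_univ_succ]
  simp only [hA0]
  have z : ∑ k, (2 * N.B 0 k * ((0 : ℝ) ^ 2 * volt v 0)
        - N.B 0 k * (volt v 0 * volt v k / cVar v θ 0 k) * ((0 : ℝ) ^ 2 + 0 * A k)) = 0 :=
    Finset.sum_eq_zero fun k _ => by ring
  rw [z, zero_add, dotProduct]
  refine Finset.sum_congr rfl fun i _ => ?_
  rw [stabilityMatrix, Matrix.sub_mulVec, Pi.sub_apply, Matrix.mulVec_diagonal, Matrix.mulVec,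
    dotProduct, Finset.sum_sub_distrib]
  simp only [Matrix.of_apply, mul_add, Finset.sum_add_distrib]
  have e2 : ∑ k, N.B i.succ k * (volt v i.succ * volt v k / cVar v θ i.succ k) * (A i.succ * A k)
      = a i * ∑ k : Fin n, N.B i.succ k.succ * (v i * v k) / cVar v θ i.succ k.succ * a k := by
    rw [Fin.sum_univ_succ, hA0, Finset.mul_sum]
    simp only [mul_zero, zero_add]
    refine Finset.sum_congr rfl fun k _ => ?_
    rw [hAs, hAs, hvs, hvs]; ring
  have e3 : ∑ k, N.B i.succ k * (volt v i.succ * volt v k / cVar v θ i.succ k) * A i.succ ^ 2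
      = a i * ((∑ k, N.B i.succ k * (v i * volt v k) / cVar v θ i.succ k) * a i) := by
    rw [Finset.sum_mul, Finset.mul_sum]
    refine Finset.sum_congr rfl fun k _ => ?_
    rw [hAs, hvs]; ring
  have e4 : ∑ k, 2 * N.B i.succ k * (A i.succ ^ 2 * volt v i.succ)
      = a i * (2 * N.totalB i.succ * v i * a i) := by
    rw [← Finset.sum_mul, ← Finset.mul_sum, hAs, hvs, totalB]; ring
  rw [e2, e3, e4]
  ring

theorem stabilityMatrix_isHermitian {n : ℕ} (N : RadialNetwork n) (v : Fin n → ℝ)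
    (θ : Fin (n + 1) → ℝ) : (N.stabilityMatrix v θ).IsHermitian := by
  refine Matrix.IsHermitian.sub (Matrix.isHermitian_diagonal _) ?_
  ext i k
  simp only [Matrix.conjTranspose_apply, Matrix.of_apply, star_trivial]
  rw [N.B_symm, cVar_symm, mul_comm (v k)]

/-- The domain of convexity of the energy function in explicit form: all phase differences along
lines have positive cosine and the stability matrix is positive semidefinite. -/
theorem isStable_iff {n : ℕ} (N : RadialNetwork n) (p q v : Fin n → ℝ) (hv : ∀ i, 0 < v i)
    (θ : Fin (n + 1) → ℝ) :
    N.IsStable p q v θ ↔ (∀ i k, N.graph.Adj i k → 0 < cVar v θ i k) ∧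
      (N.stabilityMatrix v θ).PosSemidef := by
  classical
  have grad : ∀ f : Fin (n + 1) → Fin (n + 1) → ℝ, (∀ i k, f k i = - f i k) →
      ∃ b : Fin n → ℝ, ∀ i k, N.graph.Adj i k →
        (Fin.cons 0 b : Fin (n + 1) → ℝ) i - (Fin.cons 0 b : Fin (n + 1) → ℝ) k = f i k := by
    intro f hf
    obtain ⟨b, hb⟩ := N.gradMap_surjective ⟨fun i k => if N.graph.Adj i k then f i k else 0, by
      refine ⟨fun i k => ?_, fun i k h => by simp [h]⟩
      by_cases h : N.graph.Adj i k
      · simp [h, h.symm, hf i k]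
      · have h' : ¬ N.graph.Adj k i := fun h' => h h'.symm
        simp [h, h']⟩
    refine ⟨b, fun i k h => ?_⟩
    have := congrFun (congrFun (congrArg Subtype.val hb) i) k
    simpa [gradMap, h] using this
  have split : ∀ a b : Fin n → ℝ, ∀ A D : Fin (n + 1) → ℝ, A = Fin.cons 0 a → D = Fin.cons 0 b →
      (∀ i k, N.graph.Adj i k → 0 < cVar v θ i k) →
      (∑ i, ∑ k, N.B i k * (A i ^ 2 * volt v i + A k ^ 2 * volt v k
      - 2 * (((A i + A k) / 2) ^ 2 * cVar v θ i k - (A i + A k) * (D i - D k) * sVar v θ i k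
        - (D i - D k) ^ 2 * cVar v θ i k))) / 2 =
      (dotProduct a ((N.stabilityMatrix v θ).mulVec a)) / 2 + ∑ i, ∑ k, N.B i k *
        (cVar v θ i k * (D i - D k + (A i + A k) * sVar v θ i k / (2 * cVar v θ i k)) ^ 2) := by
    intro a b A D hA hD hc
    rw [N.stabilityMatrix_form v θ a A hA]
    simp only [Finset.sum_div]
    rw [← Finset.sum_add_distrib]
    refine Finset.sum_congr rfl fun i _ => ?_
    rw [← Finset.sum_add_distrib]
    refine Finset.sum_congr rfl fun k _ => ?_
    by_cases h : N.graph.Adj i k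
    · have hc' := hc i k h
      have h2 := sVar_sq_add_cVar_sq hv θ i k
      rw [← h2]
      field_simp
      ring
    · rw [N.B_zero i k h]; ring
  constructor
  · intro hst
    have hH := fun a b => (N.energy_hessian p q v hv θ a b _ _ rfl rfl) ▸ hst a b
    have hc : ∀ i k, N.graph.Adj i k → 0 < cVar v θ i k := by
      intro i₀ k₀ hadj
      have hne : i₀ ≠ k₀ := hadj.ne
      have hB := N.B_pos i₀ k₀ hadj
      have poly : ∀ (A : Fin (n + 1) → ℝ) (a : Fin n → ℝ), A = Fin.cons 0 a → ∀ x : ℝ,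
          0 ≤ (∑ i, ∑ k, N.B i k * (A i ^ 2 * volt v i + A k ^ 2 * volt v k
            - 2 * (((A i + A k) / 2) ^ 2 * cVar v θ i k))) / 2
            + 2 * N.B i₀ k₀ * ((A i₀ + A k₀) * x * sVar v θ i₀ k₀ + x ^ 2 * cVar v θ i₀ k₀) := by
        intro A a hA x
        obtain ⟨b, hb⟩ := grad (fun i k => if i = i₀ ∧ k = k₀ then x else
          if i = k₀ ∧ k = i₀ then -x else 0) (by
            intro i k
            by_cases h1 : i = i₀ ∧ k = k₀
            · obtain ⟨rfl, rfl⟩ := h1; simp [hne, hne.symm]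
            · by_cases h2 : i = k₀ ∧ k = i₀
              · obtain ⟨rfl, rfl⟩ := h2; simp [hne, hne.symm]
              · have h1' : ¬ (k = k₀ ∧ i = i₀) := fun h => h1 ⟨h.2, h.1⟩
                have h2' : ¬ (k = i₀ ∧ i = k₀) := fun h => h2 ⟨h.2, h.1⟩
                simp [h1, h2, h1', h2'])
        have h := hH a b
        rw [← hA] at h
        set D : Fin (n + 1) → ℝ := Fin.cons 0 b with hD
        set G : Fin (n + 1) → Fin (n + 1) → ℝ := fun i k => N.B i k *
          (2 * ((A i + A k) * (D i - D k) * sVar v θ i k + (D i - D k) ^ 2 * cVar v θ i k)) with hG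
        have hG0 : ∀ i k, ¬ (i = i₀ ∧ k = k₀) → ¬ (i = k₀ ∧ k = i₀) → G i k = 0 := by
          intro i k h1 h2
          by_cases had : N.graph.Adj i k
          · have := hb i k had
            rw [if_neg h1, if_neg h2] at this
            simp only [hG, this]; ring
          · simp only [hG, N.B_zero i k had]; ring
        have hGs : ∑ i, ∑ k, G i k = G i₀ k₀ + G k₀ i₀ := by
          rw [← Finset.sum_product', ← Finset.sum_pair (f := fun y : Fin (n + 1) × Fin (n + 1) => G y.1 y.2)
            (a := (i₀, k₀)) (b := (k₀, i₀)) (by simp [hne])]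
          symm
          refine Finset.sum_subset (Finset.subset_univ _) ?_
          rintro ⟨i, k⟩ - hn
          simp only [Finset.mem_insert, Finset.mem_singleton, Prod.mk.injEq, not_or] at hn
          exact hG0 i k hn.1 hn.2
        have hb1 := hb i₀ k₀ hadj
        rw [if_pos ⟨rfl, rfl⟩] at hb1
        have hb2 : D k₀ - D i₀ = -x := by rw [← hb1]; ring
        have hG1 : G i₀ k₀ + G k₀ i₀ = 2 * (2 * N.B i₀ k₀ *
            ((A i₀ + A k₀) * x * sVar v θ i₀ k₀ + x ^ 2 * cVar v θ i₀ k₀)) := by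
          simp only [hG, hb1, hb2]
          rw [N.B_symm k₀ i₀, sVar_antisymm v θ i₀ k₀, cVar_symm v θ k₀ i₀]
          ring
        have hsum : ∑ i, ∑ k, N.B i k * (A i ^ 2 * volt v i + A k ^ 2 * volt v k
            - 2 * (((A i + A k) / 2) ^ 2 * cVar v θ i k - (A i + A k) * (D i - D k) * sVar v θ i k
            - (D i - D k) ^ 2 * cVar v θ i k)) =
            ∑ i, ∑ k, N.B i k * (A i ^ 2 * volt v i + A k ^ 2 * volt v k
            - 2 * (((A i + A k) / 2) ^ 2 * cVar v θ i k)) + ∑ i, ∑ k, G i k := by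
          rw [← Finset.sum_add_distrib]
          refine Finset.sum_congr rfl fun i _ => ?_
          rw [← Finset.sum_add_distrib]
          refine Finset.sum_congr rfl fun k _ => ?_
          simp only [hG]; ring
        rw [hsum, hGs, hG1] at h
        linarith
      have hc0 : 0 ≤ cVar v θ i₀ k₀ := by
        have h := poly (Fin.cons 0 (0 : Fin n → ℝ)) 0 rfl 1
        have hz : (Fin.cons 0 (0 : Fin n → ℝ) : Fin (n + 1) → ℝ) = 0 := by
          funext j; refine Fin.cases ?_ (fun j => ?_) j <;> simp
        rw [hz] at h
        simp at h
        exact nonneg_of_mul_nonneg_right h (by positivity)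
      rcases hc0.lt_or_eq with h | h
      · exact h
      · exfalso
        have hs := sVar_sq_add_cVar_sq hv θ i₀ k₀
        rw [← h] at hs
        have hVV := mul_pos (volt_pos hv i₀) (volt_pos hv k₀)
        have hs0 : sVar v θ i₀ k₀ ≠ 0 := by
          intro h0; rw [h0] at hs; norm_num at hs; rcases hs with h | h
          · exact (volt_pos hv _).ne' h
          · exact (volt_pos hv _).ne' h
        set A : Fin (n + 1) → ℝ := Fin.cons 0 (fun _ : Fin n => (1 : ℝ)) with hA
        have hAn : ∀ i, 0 ≤ A i := by
          intro i; refine Fin.cases ?_ (fun i => ?_) i <;> simp [hA]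
        have hA1 : ∀ i, i ≠ 0 → A i = 1 := by
          intro i; refine Fin.cases ?_ (fun i => ?_) i <;> simp [hA]
        have hσ : 0 < A i₀ + A k₀ := by
          by_cases h0 : i₀ = 0
          · have := hA1 k₀ (fun hk => hne (h0.trans hk.symm)); linarith [hAn i₀]
          · have := hA1 i₀ h0; linarith [hAn k₀]
        have hp := poly A _ hA
        rw [← h] at hp
        generalize (∑ i, ∑ k, N.B i k * (A i ^ 2 * volt v i + A k ^ 2 * volt v k
            - 2 * (((A i + A k) / 2) ^ 2 * cVar v θ i k))) / 2 = K at hp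
        have := hp (-(K + 1) / (2 * N.B i₀ k₀ * (A i₀ + A k₀) * sVar v θ i₀ k₀))
        have h3 : 2 * N.B i₀ k₀ * ((A i₀ + A k₀) *
            (-(K + 1) / (2 * N.B i₀ k₀ * (A i₀ + A k₀) * sVar v θ i₀ k₀)) * sVar v θ i₀ k₀ +
            (-(K + 1) / (2 * N.B i₀ k₀ * (A i₀ + A k₀) * sVar v θ i₀ k₀)) ^ 2 * 0) = -(K + 1) := by
          have := hσ.ne'
          have := hB.ne'
          field_simp
          ring
        rw [h3] at this
        linarith
    refine ⟨hc, Matrix.PosSemidef.of_dotProduct_mulVec_nonneg (N.stabilityMatrix_isHermitian v θ) ?_⟩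
    intro a
    set A : Fin (n + 1) → ℝ := Fin.cons 0 a with hA
    obtain ⟨b, hb⟩ := grad (fun i k => -((A i + A k) * sVar v θ i k / (2 * cVar v θ i k))) (by
      intro i k
      simp only [sVar_antisymm v θ i k, cVar_symm v θ k i]
      ring)
    have h := hH a b
    rw [split a b _ _ rfl rfl hc] at h
    have hz : ∑ i, ∑ k, N.B i k * (cVar v θ i k * ((Fin.cons 0 b : Fin (n + 1) → ℝ) i
        - (Fin.cons 0 b : Fin (n + 1) → ℝ) k + (A i + A k) * sVar v θ i k / (2 * cVar v θ i k)) ^ 2) = 0 := by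
      refine Finset.sum_eq_zero fun i _ => Finset.sum_eq_zero fun k _ => ?_
      by_cases had : N.graph.Adj i k
      · rw [hb i k had]; ring
      · rw [N.B_zero i k had, zero_mul]
    rw [← hA, hz] at h
    rw [star_trivial]
    linarith
  · rintro ⟨hc, hM⟩ a b
    rw [N.energy_hessian p q v hv θ a b _ _ rfl rfl, split a b _ _ rfl rfl hc]
    have h1 := hM.dotProduct_mulVec_nonneg a
    rw [star_trivial] at h1
    refine add_nonneg (by linarith) (Finset.sum_nonneg fun i _ => Finset.sum_nonneg fun k _ => ?_)
    by_cases had : N.graph.Adj i k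
    · have := hc i k had
      have := N.B_pos i k had
      positivity
    · rw [N.B_zero i k had, zero_mul]

end RadialNetwork

/-! ### Induction on the tree and linearity of the flows. -/

namespace RadialNetwork

variable {n : ℕ} (N : RadialNetwork n)

/-! On a tree `p` fixes the flows, so only the voltages are unknown. The reduced injection at a bus
falls when the other voltages rise (`reducedInjection_anti`). Hence the feasible set of the
relaxation is closed under componentwise maximum. It is also bounded above (`exists_bound`), so it
has a greatest point `v`, which maximizes every weighted sum of logarithms. At `v` no inequality is
slack and no square root vanishes, since otherwise a voltage could still be raised. Every power flow
solution has `c ≤ |c| = redCos`, so it is feasible and lies below `v`.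

Stability rests on the exact expansion `reducedInjection_sub`: the change of the injection from `u`
to `v` is half the stability matrix at `u` applied to the relative increase, plus a remainder that
is nonnegative by a reverse Cauchy-Schwarz inequality on the cone `s ^ 2 + c ^ 2 = x * y`. The same
inequality makes the feasible set of injections convex. The expansion is used in two ways.

If the matrix at a reduced solution `u` is positive semidefinite, pairing the expansion with the
relative increase towards the greatest point forces the remainder to vanish wherever the increase
does not. Vanishing of the remainder on a line makes the relative increase equal at both ends. As it
is `0` at bus `0`, it is `0` everywhere: a stable solution is the greatest point
(`eq_of_posSemidef`).

If the relaxation is strictly feasible, expanding at the greatest point towards a strictly feasible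
one gives a positive vector with positive image. As the off-diagonal entries are nonpositive, the
matrix is positive definite (`posDef_of_lt`). Letting the slack tend to `0` gives semidefiniteness
at every greatest point.

Continuity follows by compactness, because limits of stable solutions are stable and stable
solutions are unique. The Jacobian of the reduced injections is the stability matrix with rescaled
columns. In the interior its inverse is therefore positive within feeders. Conversely, a
feeder-positive `∂v/∂q` supplies the positive vector with positive image, so voltage-regular
solutions are stable. -/

@[simp] theorem volt_zero (v : Fin n → ℝ) : volt v 0 = 1 := rfl

@[simp] theorem volt_succ (v : Fin n → ℝ) (i : Fin n) : volt v i.succ = v i := rfl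

theorem volt_mono {u v : Fin n → ℝ} (h : u ≤ v) (i : Fin (n + 1)) : volt u i ≤ volt v i := by
  refine Fin.cases ?_ (fun i => ?_) i
  · simp
  · simpa using h i

theorem continuous_volt (i : Fin (n + 1)) : Continuous fun v : Fin n → ℝ => volt v i := by
  refine Fin.cases ?_ (fun i => ?_) i
  · simpa using continuous_const
  · simpa using continuous_apply i

theorem B_nonneg (i k : Fin (n + 1)) : 0 ≤ N.B i k := by
  by_cases h : N.graph.Adj i k
  · exact (N.B_pos i k h).le
  · exact (N.B_zero i k h).ge

/-- Induction along the network, starting at the substation. -/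
theorem bus_induction {P : Fin (n + 1) → Prop} (h0 : P 0)
    (hs : ∀ (i : Fin n) k, N.graph.Adj i.succ k → P k → P i.succ) (i : Fin (n + 1)) : P i := by
  obtain ⟨w⟩ := N.isTree.connected.preconnected i 0
  have walk : ∀ {x y : Fin (n + 1)}, N.graph.Walk x y → P y → P x := by
    intro x y w hy
    induction w with
    | nil => exact hy
    | @cons a b _ h _ ih =>
      rcases Fin.eq_zero_or_eq_succ a with rfl | ⟨j, rfl⟩
      · exact h0
      · exact hs j b h (ih hy)
  exact walk w h0

/-- A statement about lines that is symmetric in the two ends need only be checked on lines that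
start at a bus other than the substation. -/
theorem line_induction {P : Fin (n + 1) → Fin (n + 1) → Prop} (hP : ∀ i k, P i k → P k i)
    (hs : ∀ (i : Fin n) k, N.graph.Adj i.succ k → P i.succ k) (i k : Fin (n + 1))
    (h : N.graph.Adj i k) : P i k := by
  rcases Fin.eq_zero_or_eq_succ i with rfl | ⟨j, rfl⟩
  · rcases Fin.eq_zero_or_eq_succ k with rfl | ⟨l, rfl⟩
    · exact absurd h (N.graph.irrefl)
    · exact hP _ _ (hs l 0 h.symm)
  · exact hs j k h

/-- The line flows as a linear function of the injections. -/
noncomputable def flowMap : (Fin n → ℝ) →ₗ[ℝ] (Fin (n + 1) → Fin (n + 1) → ℝ) :=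
  N.edgeFun.subtype ∘ₗ
    (LinearEquiv.ofBijective N.divMap ⟨N.divMap_injective, N.divMap_surjective⟩).symm.toLinearMap

theorem flow_unique {p : Fin n → ℝ} {s : Fin (n + 1) → Fin (n + 1) → ℝ} (h : N.IsFlow p s) :
    N.flow p = s :=
  (N.existsUnique_flow p).unique (N.isFlow_flow p) h

theorem flow_eq_flowMap (p : Fin n → ℝ) : N.flow p = N.flowMap p := by
  apply N.flow_unique
  set s := (LinearEquiv.ofBijective N.divMap ⟨N.divMap_injective, N.divMap_surjective⟩).symm p
    with hs
  have h : N.divMap s = p :=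
    (LinearEquiv.ofBijective N.divMap ⟨N.divMap_injective, N.divMap_surjective⟩).apply_symm_apply p
  exact ⟨s.2.1, s.2.2, fun i => (congrFun h i).symm⟩

theorem continuous_flow (i k : Fin (n + 1)) : Continuous fun p => N.flow p i k := by
  simp only [flow_eq_flowMap]
  exact (continuous_apply k).comp ((continuous_apply i).comp N.flowMap.continuous_of_finiteDimensional)

theorem flow_comb (a b : ℝ) (p p' : Fin n → ℝ) (i k : Fin (n + 1)) :
    N.flow (a • p + b • p') i k = a * N.flow p i k + b * N.flow p' i k := by
  simp [flow_eq_flowMap]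

theorem flow_antisymm (p : Fin n → ℝ) (i k : Fin (n + 1)) : N.flow p k i = - N.flow p i k :=
  (N.isFlow_flow p).1 i k

/-! ### Monotonicity of the reduced equations. -/

/-- The variable `c i k` determined by `v` in the reduced equations. -/
noncomputable def redCos (p v : Fin n → ℝ) (i k : Fin (n + 1)) : ℝ :=
  √(volt v i * volt v k - N.flow p i k ^ 2)

theorem redCos_symm (p v : Fin n → ℝ) (i k : Fin (n + 1)) :
    N.redCos p v i k = N.redCos p v k i := by
  rw [redCos, redCos, N.flow_antisymm p i k, neg_sq, mul_comm]

theorem redCos_nonneg (p v : Fin n → ℝ) (i k : Fin (n + 1)) : 0 ≤ N.redCos p v i k :=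
  Real.sqrt_nonneg _

theorem IsAdmissible.redCos_sq {N : RadialNetwork n} {p v : Fin n → ℝ} (h : N.IsAdmissible p v)
    {i k : Fin (n + 1)} (hik : N.graph.Adj i k) :
    N.redCos p v i k ^ 2 = volt v i * volt v k - N.flow p i k ^ 2 :=
  Real.sq_sqrt (sub_nonneg.2 (h.sq_le i k hik))

theorem redCos_mono {p u v : Fin n → ℝ} (hu : ∀ i, 0 < u i) (h : u ≤ v) (i k : Fin (n + 1)) :
    N.redCos p u i k ≤ N.redCos p v i k := by
  refine Real.sqrt_le_sqrt (sub_le_sub_right ?_ _)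
  exact mul_le_mul (volt_mono h i) (volt_mono h k) (volt_pos hu k).le
    ((volt_pos hu i).le.trans (volt_mono h i))

theorem continuous_redCos (i k : Fin (n + 1)) :
    Continuous fun y : (Fin n → ℝ) × (Fin n → ℝ) => N.redCos y.1 y.2 i k := by
  have h1 := (continuous_volt (n := n) i).comp (continuous_snd (X := Fin n → ℝ))
  have h2 := (continuous_volt (n := n) k).comp (continuous_snd (X := Fin n → ℝ))
  have h3 := (N.continuous_flow i k).comp (continuous_fst (Y := Fin n → ℝ))
  exact ((h1.mul h2).sub (h3.pow 2)).sqrt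

theorem reducedInjection_eq (p v : Fin n → ℝ) (i : Fin n) :
    N.reducedInjection p v i = ∑ k, N.B i.succ k * (v i - N.redCos p v i.succ k) := by
  simp only [reducedInjection, totalB, mul_sub, Finset.sum_sub_distrib, Finset.sum_mul, redCos,
    volt_succ]

theorem continuous_reducedInjection (i : Fin n) :
    Continuous fun y : (Fin n → ℝ) × (Fin n → ℝ) => N.reducedInjection y.1 y.2 i := by
  simp only [reducedInjection_eq]
  refine continuous_finsetSum _ fun k _ => continuous_const.mul (Continuous.sub ?_ ?_)
  · exact (continuous_apply i).comp continuous_snd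
  · exact N.continuous_redCos i.succ k

/-- Raising the voltages at the other buses lowers the reactive injection. -/
theorem reducedInjection_anti {p u v : Fin n → ℝ} (hu : ∀ i, 0 < u i) (h : u ≤ v) {i : Fin n}
    (hi : u i = v i) : N.reducedInjection p v i ≤ N.reducedInjection p u i := by
  simp only [reducedInjection_eq, ← hi]
  exact Finset.sum_le_sum fun k _ => mul_le_mul_of_nonneg_left
    (sub_le_sub_left (N.redCos_mono hu h _ _) _) (N.B_nonneg _ _)

theorem IsAdmissible.mono {N : RadialNetwork n} {p u v : Fin n → ℝ} (hu : N.IsAdmissible p u)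
    (h : u ≤ v) : N.IsAdmissible p v :=
  ⟨fun i => (hu.pos i).trans_le (h i), fun i k hik => (hu.sq_le i k hik).trans
    (mul_le_mul (volt_mono h i) (volt_mono h k) (volt_pos hu.pos k).le
      ((volt_pos hu.pos i).le.trans (volt_mono h i)))⟩

/-- At each bus, the point with the larger voltage supplies the inequality: passing from it to the
maximum keeps that voltage and only raises the others. -/
theorem IsFeasible.sup {N : RadialNetwork n} {p q u v : Fin n → ℝ} (hu : N.IsFeasible p q u)
    (hv : N.IsFeasible p q v) : N.IsFeasible p q (u ⊔ v) := by
  refine ⟨hu.1.mono le_sup_left, fun i => ?_⟩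
  rcases le_total (u i) (v i) with h | h
  · exact (N.reducedInjection_anti hv.1.pos le_sup_right (by simp [h])).trans (hv.2 i)
  · exact (N.reducedInjection_anti hu.1.pos le_sup_left (by simp [h])).trans (hu.2 i)

/-! ### The greatest feasible point. -/

/-- Voltages are bounded in terms of the total reactive injection. -/
theorem exists_bound (K : ℝ) : ∃ R, ∀ p q v, N.IsFeasible p q v → ∑ i, q i ≤ K → ∀ i, v i ≤ R := by
  -- A bound on the energy of every line bounds the root voltages, starting from the value 1 at bus
  -- 0 and moving outwards.
  have key : ∀ i, ∃ R : ℝ, ∀ x : Fin (n + 1) → ℝ, x 0 = 1 →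
      (∀ i k, N.graph.Adj i k → N.B i k * (x i - x k) ^ 2 ≤ 2 * (K + N.totalB 0)) → x i ≤ R := by
    refine N.bus_induction ⟨1, fun x h _ => h.le⟩ fun i k hik ⟨R, hR⟩ => ?_
    refine ⟨R + √(2 * (K + N.totalB 0) / N.B i.succ k), fun x h0 h => ?_⟩
    have h1 := hR x h0 h
    have h2 : x i.succ - x k ≤ √(2 * (K + N.totalB 0) / N.B i.succ k) := by
      apply Real.le_sqrt_of_sq_le
      rw [le_div_iff₀' (N.B_pos _ _ hik)]
      exact h _ _ hik
    linarith
  choose R hR using key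
  refine ⟨∑ i, (|R i|) ^ 2, fun p q v hv hq i => ?_⟩
  -- Since each root is at most `x i * x k` with `x = √v`, the feasibility inequalities become
  -- Laplacian-type inequalities in `x`; summed over all buses they bound the Dirichlet energy.
  set x : Fin (n + 1) → ℝ := fun i => √(volt v i) with hx
  have hx0 : x 0 = 1 := by simp [hx]
  have hxx : ∀ i, x i ^ 2 = volt v i := fun i => Real.sq_sqrt (volt_pos hv.1.pos i).le
  have hxn : ∀ i, 0 ≤ x i := fun i => Real.sqrt_nonneg _
  have hc : ∀ i k, N.redCos p v i k ≤ x i * x k := by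
    intro i k
    rw [hx, ← Real.sqrt_mul (volt_pos hv.1.pos i).le]
    exact Real.sqrt_le_sqrt (sub_le_self _ (sq_nonneg _))
  have hi : ∀ i : Fin n, ∑ k, N.B i.succ k * (x i.succ ^ 2 - x i.succ * x k) ≤ q i := by
    intro i
    refine le_trans ?_ (hv.2 i)
    rw [reducedInjection_eq]
    refine Finset.sum_le_sum fun k _ => mul_le_mul_of_nonneg_left ?_ (N.B_nonneg _ _)
    rw [hxx, volt_succ]
    exact sub_le_sub_left (hc _ _) _
  -- Bus 0 carries no constraint, but its row is bounded trivially because `x 0 = 1` and `x k ≥ 0`.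
  have h0 : ∑ k, N.B 0 k * (x 0 ^ 2 - x 0 * x k) ≤ N.totalB 0 := by
    refine Finset.sum_le_sum fun k _ => ?_
    rw [hx0]
    nlinarith [N.B_nonneg 0 k, mul_nonneg (N.B_nonneg 0 k) (hxn k)]
  have htot : ∑ i, ∑ k, N.B i k * (x i - x k) ^ 2 ≤ 2 * (K + N.totalB 0) := by
    have e : ∑ i, ∑ k, N.B i k * (x i - x k) ^ 2 =
        2 * ∑ i, ∑ k, N.B i k * (x i ^ 2 - x i * x k) := by
      have e1 : ∑ i, ∑ k, N.B i k * (x i ^ 2 - x i * x k) =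
          ∑ i, ∑ k, N.B i k * (x k ^ 2 - x i * x k) := by
        rw [Finset.sum_comm]
        refine Finset.sum_congr rfl fun i _ => Finset.sum_congr rfl fun k _ => ?_
        rw [N.B_symm]; ring
      rw [two_mul]
      conv_rhs => rw [e1]; arg 2; rw [← e1]
      simp only [← Finset.sum_add_distrib]
      refine Finset.sum_congr rfl fun i _ => Finset.sum_congr rfl fun k _ => ?_
      ring
    rw [e, Fin.sum_univ_succ]
    have := Finset.sum_le_sum fun i (_ : i ∈ Finset.univ) => hi i
    linarith
  have hline : ∀ i k, N.graph.Adj i k → N.B i k * (x i - x k) ^ 2 ≤ 2 * (K + N.totalB 0) := by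
    intro i k _
    refine le_trans ?_ htot
    have nn : ∀ i k, 0 ≤ N.B i k * (x i - x k) ^ 2 :=
      fun i k => mul_nonneg (N.B_nonneg i k) (sq_nonneg _)
    exact (Finset.single_le_sum (f := fun k => N.B i k * (x i - x k) ^ 2) (fun k _ => nn i k)
      (Finset.mem_univ k)).trans
      (Finset.single_le_sum (f := fun i => ∑ k, N.B i k * (x i - x k) ^ 2)
        (fun i _ => Finset.sum_nonneg fun k _ => nn i k) (Finset.mem_univ i))
  have h1 : x i.succ ≤ |R i.succ| := (hR i.succ x hx0 hline).trans (le_abs_self _)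
  calc v i = x i.succ ^ 2 := by rw [hxx, volt_succ]
    _ ≤ |R i.succ| ^ 2 := pow_le_pow_left₀ (hxn _) h1 2
    _ ≤ _ := Finset.single_le_sum (f := fun i => |R i| ^ 2) (fun i _ => sq_nonneg _)
      (Finset.mem_univ _)

/-- A feasible relaxation has a componentwise greatest feasible point. -/
theorem exists_isGreatest {p q : Fin n → ℝ} (h : (p, q) ∈ N.feasibleInjections) :
    ∃ v, IsGreatest {u | N.IsFeasible p q u} v := by
  obtain ⟨u₀, hu₀⟩ := h
  obtain ⟨R, hR⟩ := N.exists_bound (∑ i, q i)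
  -- Above a fixed feasible point admissibility is automatic, so only the closed inequalities remain
  -- and the set is compact.
  set K : Set (Fin n → ℝ) := {u | u₀ ≤ u ∧ N.IsFeasible p q u} with hK
  have hKsub : K ⊆ Set.Icc u₀ fun _ => R := fun u hu => ⟨hu.1, hR p q u hu.2 le_rfl⟩
  have hKcl : IsClosed K := by
    have : K = {u | u₀ ≤ u} ∩ {u | ∀ i, N.reducedInjection p u i ≤ q i} := by
      ext u
      exact ⟨fun hu => ⟨hu.1, hu.2.2⟩, fun hu => ⟨hu.1, hu₀.1.mono hu.1, hu.2⟩⟩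
    rw [this]
    refine isClosed_Ici.inter ?_
    rw [Set.ofPred_forall]
    refine isClosed_iInter fun i => isClosed_le ?_ continuous_const
    exact (N.continuous_reducedInjection i).comp (Continuous.prodMk_right p)
  have hKc : IsCompact K := isCompact_Icc.of_isClosed_subset hKcl hKsub
  -- A maximizer of the coordinate sum is greatest: its join with any feasible point is again in `K`
  -- and cannot have a larger sum.
  obtain ⟨v, hv, hmax⟩ := hKc.exists_isMaxOn ⟨u₀, le_rfl, hu₀⟩
    (f := fun u : Fin n → ℝ => ∑ i, u i) (by fun_prop)
  refine ⟨v, hv.2, fun u hu i => ?_⟩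
  have h1 : u ⊔ v ∈ K := ⟨hv.1.trans le_sup_right, IsFeasible.sup hu hv.2⟩
  have h2 : ∑ i, (u ⊔ v) i ≤ ∑ i, v i := hmax h1
  have h3 := (Finset.sum_eq_sum_iff_of_le (s := Finset.univ) (f := v) (g := u ⊔ v)
    fun i _ => (le_sup_right : v ≤ u ⊔ v) i).1
    (le_antisymm (Finset.sum_le_sum fun i _ => (le_sup_right : v ≤ u ⊔ v) i) h2) i
    (Finset.mem_univ i)
  rw [h3]
  exact (le_sup_left : u ≤ u ⊔ v) i

/-- Raising the voltage at one bus of a feasible point. -/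
theorem IsFeasible.update {N : RadialNetwork n} {p q v : Fin n → ℝ} (hv : N.IsFeasible p q v)
    {j : Fin n} {ε : ℝ} (hε : 0 ≤ ε)
    (h : ∑ k, N.B j.succ k * (v j + ε - N.redCos p (Function.update v j (v j + ε)) j.succ k) ≤ q j) :
    N.IsFeasible p q (Function.update v j (v j + ε)) := by
  have hle : v ≤ Function.update v j (v j + ε) := by
    intro i
    by_cases hi : i = j
    · subst hi; simpa using hε
    · simp [hi]
  refine ⟨hv.1.mono hle, fun i => ?_⟩
  by_cases hi : i = j
  · subst hi
    rw [reducedInjection_eq]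
    simpa using h
  · exact (N.reducedInjection_anti hv.1.pos hle (by simp [hi])).trans (hv.2 i)

/-- A slack inequality would allow the voltage at that bus to be raised slightly, and this only
relaxes the inequalities at the other buses. -/
theorem isReducedSolution_of_isGreatest {p q v : Fin n → ℝ}
    (h : IsGreatest {u | N.IsFeasible p q u} v) : N.IsReducedSolution p q v := by
  have hv : N.IsFeasible p q v := h.1
  refine ⟨hv.1, fun i => le_antisymm (hv.2 i) ?_⟩
  by_contra! hlt
  have hB : 0 ≤ N.totalB i.succ := Finset.sum_nonneg fun k _ => N.B_nonneg _ _
  -- The injection grows with its own voltage at rate at most `totalB`; the added 1 keeps the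
  -- denominator positive.
  set ε := (q i - N.reducedInjection p v i) / (N.totalB i.succ + 1) with hε
  have hε0 : 0 < ε := div_pos (sub_pos.2 hlt) (by positivity)
  have hε1 : N.totalB i.succ * ε ≤ q i - N.reducedInjection p v i := by
    have : ε * (N.totalB i.succ + 1) = q i - N.reducedInjection p v i := by
      rw [hε]; field_simp
    linarith
  have hle : v ≤ Function.update v i (v i + ε) := by
    rw [le_update_iff]
    exact ⟨by linarith, fun _ _ => le_rfl⟩
  have hf := hv.update hε0.le (j := i) (by
    calc _ ≤ ∑ k, (N.B i.succ k * (v i - N.redCos p v i.succ k) + N.B i.succ k * ε) := by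
          refine Finset.sum_le_sum fun k _ => ?_
          rw [← mul_add]
          refine mul_le_mul_of_nonneg_left ?_ (N.B_nonneg _ _)
          linarith [N.redCos_mono (p := p) hv.1.pos hle i.succ k]
      _ = N.reducedInjection p v i + N.totalB i.succ * ε := by
          rw [Finset.sum_add_distrib, ← Finset.sum_mul, reducedInjection_eq, totalB]
      _ ≤ q i := by linarith)
  have := h.2 hf i
  simp at this
  linarith

/-- At the greatest feasible point no square root in the reduced equations vanishes. -/
theorem redCos_pos_of_isGreatest {p q v : Fin n → ℝ}
    (h : IsGreatest {u | N.IsFeasible p q u} v) :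
    ∀ i k, N.graph.Adj i k → 0 < N.redCos p v i k := by
  have hv : N.IsFeasible p q v := h.1
  refine N.line_induction (fun i k h => by rwa [redCos_symm]) fun j k hjk => ?_
  refine (N.redCos_nonneg _ _ _ _).lt_of_ne fun h0 => ?_
  have hB : N.B j.succ k ≤ N.totalB j.succ :=
    Finset.single_le_sum (f := N.B j.succ) (fun k _ => N.B_nonneg _ _) (Finset.mem_univ k)
  have hBk := N.B_pos _ _ hjk
  have hV := volt_pos hv.1.pos k
  have hBt : 0 < N.totalB j.succ := hBk.trans_le hB
  -- If the root on the line vanishes, raising `v j` by `ε` costs at most `totalB * ε`, while the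
  -- root grows from 0 to at least `√(ε * volt v k)`. This `ε` is the break-even value, at which
  -- gain and cost cancel exactly.
  set ε := (N.B j.succ k / N.totalB j.succ) ^ 2 * volt v k with hε
  have hε0 : 0 < ε := by positivity
  have hle : v ≤ Function.update v j (v j + ε) := by
    rw [le_update_iff]
    exact ⟨by linarith, fun _ _ => le_rfl⟩
  have hgain : N.B j.succ k / N.totalB j.succ * volt v k ≤
      N.redCos p (Function.update v j (v j + ε)) j.succ k := by
    apply Real.le_sqrt_of_sq_le
    have e := hv.1.redCos_sq hjk
    rw [← h0, volt_succ] at e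
    have hk : volt (Function.update v j (v j + ε)) k = volt v k := by
      rcases Fin.eq_zero_or_eq_succ k with rfl | ⟨l, rfl⟩
      · rfl
      · have : l ≠ j := fun h => hjk.ne (by rw [h])
        simp [this]
    rw [hk, volt_succ, Function.update_self]
    have : (N.B j.succ k / N.totalB j.succ * volt v k) ^ 2 = ε * volt v k := by rw [hε]; ring
    nlinarith
  have hf := hv.update hε0.le (j := j) (by
    calc _ ≤ ∑ l, (N.B j.succ l * (v j - N.redCos p v j.succ l) + N.B j.succ l * ε -
            if l = k then N.B j.succ k * (N.B j.succ k / N.totalB j.succ * volt v k) else 0) := by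
          refine Finset.sum_le_sum fun l _ => ?_
          split_ifs with hl
          · subst hl
            rw [← h0]
            have := mul_le_mul_of_nonneg_left hgain hBk.le
            linarith
          · have := mul_le_mul_of_nonneg_left (N.redCos_mono (p := p) hv.1.pos hle j.succ l)
              (N.B_nonneg j.succ l)
            linarith
      _ = N.reducedInjection p v j + N.totalB j.succ * ε -
            N.B j.succ k * (N.B j.succ k / N.totalB j.succ * volt v k) := by
          rw [Finset.sum_sub_distrib, Finset.sum_add_distrib, ← Finset.sum_mul,
            reducedInjection_eq, totalB, Finset.sum_ite_eq']
          simp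
      _ = N.reducedInjection p v j := by rw [hε]; field_simp; ring
      _ ≤ q j := hv.2 j)
  have := h.2 hf j
  simp at this
  linarith

end RadialNetwork

/-! ### The cone inequality and convexity of the feasible injections. -/

namespace RadialNetwork

variable {n : ℕ} (N : RadialNetwork n)

/-- The reverse Cauchy-Schwarz inequality on the cone `s ^ 2 + c ^ 2 = x * y`. -/
theorem cone_ineq {x y s c x' y' s' c' : ℝ} (hx : 0 ≤ x) (hy : 0 ≤ y) (hx' : 0 ≤ x') (hy' : 0 ≤ y')
    (h : s ^ 2 + c ^ 2 = x * y) (h' : s' ^ 2 + c' ^ 2 = x' * y') :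
    2 * (s * s' + c * c') ≤ x' * y + x * y' := by
  refine le_of_sq_le_sq ?_ (by positivity)
  -- The difference of the squares is `(x' * y - x * y') ^ 2` plus four times the Lagrange term `(s
  -- * c' - c * s') ^ 2`.
  have e : x' * y * (x * y') = (s ^ 2 + c ^ 2) * (s' ^ 2 + c' ^ 2) := by rw [h, h']; ring
  nlinarith [sq_nonneg (s * c' - c * s'), sq_nonneg (x' * y - x * y')]

/-- Equality in `cone_ineq`. -/
theorem cone_eq {x y s c x' y' s' c' : ℝ} (hx : 0 ≤ x) (hy : 0 ≤ y) (hx' : 0 ≤ x') (hy' : 0 ≤ y')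
    (h : s ^ 2 + c ^ 2 = x * y) (h' : s' ^ 2 + c' ^ 2 = x' * y')
    (he : x' * y + x * y' ≤ 2 * (s * s' + c * c')) : x' * y = x * y' := by
  have e : x' * y * (x * y') = (s ^ 2 + c ^ 2) * (s' ^ 2 + c' ^ 2) := by rw [h, h']; ring
  have h0 : 0 ≤ x' * y + x * y' := by positivity
  have h2 := pow_le_pow_left₀ h0 he 2
  have : (x' * y - x * y') ^ 2 = 0 :=
    le_antisymm (by nlinarith [sq_nonneg (s * c' - c * s')]) (sq_nonneg _)
  exact sub_eq_zero.1 (pow_eq_zero_iff (by norm_num)|>.1 this)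

theorem volt_comb {a b : ℝ} (hab : a + b = 1) (u v : Fin n → ℝ) (i : Fin (n + 1)) :
    volt (a • u + b • v) i = a * volt u i + b * volt v i := by
  refine Fin.cases ?_ (fun i => ?_) i
  · simp [hab]
  · simp

/-- In the variables `(v, s, c)` the relaxation consists of linear constraints and the convex cones
`s ^ 2 + c ^ 2 ≤ v i * v k`, and `s` is linear in `p`. The combination of the two systems of roots
is thus an admissible `c`, and the true root is at least as large. -/
theorem convex_feasibleInjections : Convex ℝ N.feasibleInjections := by
  rintro ⟨p, q⟩ ⟨u, hu⟩ ⟨p', q'⟩ ⟨v, hv⟩ a b ha hb hab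
  have hpu := fun i => (volt_pos hu.1.pos i).le
  have hpv := fun i => (volt_pos hv.1.pos i).le
  have key : ∀ i k, N.graph.Adj i k →
      (a * N.redCos p u i k + b * N.redCos p' v i k) ^ 2 ≤
        volt (a • u + b • v) i * volt (a • u + b • v) k - N.flow (a • p + b • p') i k ^ 2 := by
    intro i k hik
    have h1 := hu.1.redCos_sq hik
    have h2 := hv.1.redCos_sq hik
    have h3 := cone_ineq (s := N.flow p i k) (c := N.redCos p u i k) (s' := N.flow p' i k)
      (c' := N.redCos p' v i k) (hpu i) (hpu k) (hpv i) (hpv k) (by linarith) (by linarith)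
    rw [volt_comb hab, volt_comb hab, flow_comb]
    -- The pure terms, weighted by `a ^ 2` and `b ^ 2`, are equalities; only the cross terms,
    -- weighted by `a * b`, need the cone inequality.
    have h4 := mul_le_mul_of_nonneg_left h3 (mul_nonneg ha hb)
    have h5 := congrArg (a ^ 2 * ·) h1
    have h6 := congrArg (b ^ 2 * ·) h2
    simp only at h5 h6
    linarith
  refine ⟨a • u + b • v, ⟨fun i => ?_, fun i k hik => ?_⟩, fun i => ?_⟩
  · simp only [Pi.add_apply, Pi.smul_apply, smul_eq_mul]
    rcases ha.eq_or_lt with rfl | ha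
    · have : b = 1 := by linarith
      simpa [this] using hv.1.pos i
    · exact add_pos_of_pos_of_nonneg (mul_pos ha (hu.1.pos i)) (mul_nonneg hb (hv.1.pos i).le)
  · exact sub_nonneg.1 ((sq_nonneg _).trans (key i k hik))
  · have h1 := mul_le_mul_of_nonneg_left (hu.2 i) ha
    have h2 := mul_le_mul_of_nonneg_left (hv.2 i) hb
    refine le_trans ?_ (add_le_add h1 h2)
    simp only [reducedInjection_eq, Finset.mul_sum]
    rw [← Finset.sum_add_distrib]
    refine Finset.sum_le_sum fun k _ => ?_
    by_cases hik : N.graph.Adj i.succ k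
    · have h3 : a * N.redCos p u i.succ k + b * N.redCos p' v i.succ k ≤
          N.redCos (a • (p, q) + b • (p', q')).1 (a • u + b • v) i.succ k :=
        Real.le_sqrt_of_sq_le (key _ _ hik)
      have h4 := mul_le_mul_of_nonneg_left h3 (N.B_nonneg i.succ k)
      simp only [Pi.add_apply, Pi.smul_apply, smul_eq_mul]
      linarith
    · simp [N.B_zero _ _ hik]

/-! ### Passage between power flow solutions, reduced solutions and phases. -/

theorem IsSolution.isAdmissible {N : RadialNetwork n} {p q v : Fin n → ℝ}
    {c : Fin (n + 1) → Fin (n + 1) → ℝ} (h : N.IsSolution p q v c) : N.IsAdmissible p v :=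
  ⟨h.pos, fun i k hik => by nlinarith [h.consistent i k hik, sq_nonneg (c i k)]⟩

theorem IsSolution.redCos_eq {N : RadialNetwork n} {p q v : Fin n → ℝ}
    {c : Fin (n + 1) → Fin (n + 1) → ℝ} (h : N.IsSolution p q v c) {i k : Fin (n + 1)}
    (hik : N.graph.Adj i k) : N.redCos p v i k = |c i k| := by
  rw [redCos, ← h.consistent i k hik, add_sub_cancel_left, Real.sqrt_sq_eq_abs]

theorem IsSolution.reactive' {N : RadialNetwork n} {p q v : Fin n → ℝ}
    {c : Fin (n + 1) → Fin (n + 1) → ℝ} (h : N.IsSolution p q v c) (i : Fin n) :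
    ∑ k, N.B i.succ k * (v i - c i.succ k) = q i := by
  rw [← h.reactive i]
  simp only [mul_sub, Finset.sum_sub_distrib, Finset.sum_mul, totalB]

/-- The cosines of a solution may be negative, but `c ≤ |c| = redCos`. This one comparison puts
every solution inside the relaxation. -/
theorem IsSolution.term_le {N : RadialNetwork n} {p q v : Fin n → ℝ}
    {c : Fin (n + 1) → Fin (n + 1) → ℝ} (h : N.IsSolution p q v c) (i k : Fin (n + 1)) (x : ℝ) :
    N.B i k * (x - N.redCos p v i k) ≤ N.B i k * (x - c i k) := by
  by_cases hik : N.graph.Adj i k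
  · rw [h.redCos_eq hik]
    exact mul_le_mul_of_nonneg_left (sub_le_sub_left (le_abs_self _) _) (N.B_nonneg _ _)
  · simp [N.B_zero _ _ hik]

theorem IsSolution.isFeasible {N : RadialNetwork n} {p q v : Fin n → ℝ}
    {c : Fin (n + 1) → Fin (n + 1) → ℝ} (h : N.IsSolution p q v c) : N.IsFeasible p q v := by
  refine ⟨h.isAdmissible, fun i => ?_⟩
  rw [← h.reactive' i, reducedInjection_eq]
  exact Finset.sum_le_sum fun k _ => h.term_le _ _ _

/-- If the voltages of a solution satisfy the reduced equations, then its cosines are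
nonnegative. -/
theorem IsSolution.eq_redCos {N : RadialNetwork n} {p q v : Fin n → ℝ}
    {c : Fin (n + 1) → Fin (n + 1) → ℝ} (h : N.IsSolution p q v c)
    (hr : N.IsReducedSolution p q v) :
    ∀ i k, N.graph.Adj i k → c i k = N.redCos p v i k := by
  refine N.line_induction (fun i k h' => by rw [h.symm, redCos_symm, h']) fun i k hik => ?_
  have h1 := hr.2 i
  rw [← h.reactive' i, reducedInjection_eq] at h1
  -- The two sums agree and compare term by term, so they agree term by term.
  have h2 := (Finset.sum_eq_sum_iff_of_le fun k _ => h.term_le i.succ k (v i)).1 h1 k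
    (Finset.mem_univ k)
  have h3 := mul_left_cancel₀ (N.B_pos _ _ hik).ne' h2
  linarith

theorem IsPolarSolution.flow_eq {N : RadialNetwork n} {p q v : Fin n → ℝ} {θ : Fin (n + 1) → ℝ}
    (h : N.IsPolarSolution p q v θ) {i k : Fin (n + 1)} (hik : N.graph.Adj i k) :
    N.flow p i k = sVar v θ i k := by
  classical
  -- `sVar` need not vanish off the lines, so it is cut off before uniqueness of the flow applies.
  rw [N.flow_unique (s := fun i k => if N.graph.Adj i k then sVar v θ i k else 0)]
  · simp [hik]
  · refine ⟨fun i k => ?_, fun i k h => by simp [h], fun i => ?_⟩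
    · simp only [N.graph.adj_comm k i, sVar_antisymm v θ i k]
      split_ifs <;> simp
    · rw [h.active i]
      refine Finset.sum_congr rfl fun k _ => ?_
      by_cases hk : N.graph.Adj i.succ k
      · simp [hk]
      · simp [N.B_zero _ _ hk]

theorem IsPolarSolution.isSolution {N : RadialNetwork n} {p q v : Fin n → ℝ}
    {θ : Fin (n + 1) → ℝ} (h : N.IsPolarSolution p q v θ) : N.IsSolution p q v (cVar v θ) :=
  ⟨h.pos, cVar_symm v θ, fun i => (h.reactive i).symm, fun i k hik => by
    rw [h.flow_eq hik, sVar_sq_add_cVar_sq h.pos]⟩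

/-- A tree has no cycle conditions: every antisymmetric function on the lines is the difference of a
potential, which is determined by its value at bus 0. -/
theorem existsUnique_isPhaseOf (p v : Fin n → ℝ) : ∃! θ, N.IsPhaseOf p v θ := by
  classical
  obtain ⟨b, hb⟩ := N.gradMap_surjective ⟨fun i k => if N.graph.Adj i k then
      Real.arcsin (N.flow p i k / √(volt v i * volt v k)) else 0, by
    refine ⟨fun i k => ?_, fun i k h => by simp [h]⟩
    simp only [N.graph.adj_comm k i, N.flow_antisymm p i k, mul_comm (volt v k), neg_div,
      Real.arcsin_neg]
    split_ifs <;> simp⟩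
  refine ⟨Fin.cons 0 b, ⟨rfl, fun i k h => ?_⟩, fun φ hφ => ?_⟩
  · have := congrFun (congrFun (congrArg Subtype.val hb) i) k
    simpa [gradMap, h] using this
  · funext i
    refine N.bus_induction (P := fun i => φ i = (Fin.cons 0 b : Fin (n + 1) → ℝ) i) hφ.1
      (fun i k hik hk => ?_) i
    have h1 := hφ.2 _ _ hik
    have h2 := congrFun (congrFun (congrArg Subtype.val hb) i.succ) k
    simp [gradMap, hik] at h2
    rw [volt_succ, ← h2, hk] at h1
    simpa using h1

theorem sVar_of_isPhaseOf {p v : Fin n → ℝ} (hv : N.IsAdmissible p v) {θ : Fin (n + 1) → ℝ}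
    (h : N.IsPhaseOf p v θ) {i k : Fin (n + 1)} (hik : N.graph.Adj i k) :
    sVar v θ i k = N.flow p i k := by
  have hpos : 0 < volt v i * volt v k := mul_pos (volt_pos hv.pos i) (volt_pos hv.pos k)
  have hs := Real.sqrt_pos.2 hpos
  have habs : |N.flow p i k / √(volt v i * volt v k)| ≤ 1 := by
    rw [abs_div, abs_of_pos hs, div_le_one hs]
    exact Real.abs_le_sqrt (hv.sq_le i k hik)
  rw [sVar, h.2 i k hik, Real.sin_arcsin (abs_le.1 habs).1 (abs_le.1 habs).2]
  field_simp

/-- The arcsine takes values with nonnegative cosine, so it selects the nonnegative root. -/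
theorem cVar_of_isPhaseOf {p v : Fin n → ℝ} (hv : N.IsAdmissible p v) {θ : Fin (n + 1) → ℝ}
    (h : N.IsPhaseOf p v θ) {i k : Fin (n + 1)} (hik : N.graph.Adj i k) :
    cVar v θ i k = N.redCos p v i k := by
  have h0 : 0 ≤ cVar v θ i k := by
    rw [cVar, h.2 i k hik]
    exact mul_nonneg (Real.sqrt_nonneg _) (Real.cos_arcsin_nonneg _)
  have h1 := sVar_sq_add_cVar_sq hv.pos θ i k
  rw [N.sVar_of_isPhaseOf hv h hik] at h1
  rw [redCos, ← h1, add_sub_cancel_left, Real.sqrt_sq h0]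

theorem isPolarSolution_of_isPhaseOf {p q v : Fin n → ℝ} (hv : N.IsReducedSolution p q v)
    {θ : Fin (n + 1) → ℝ} (h : N.IsPhaseOf p v θ) : N.IsPolarSolution p q v θ := by
  refine ⟨hv.1.pos, h.1, fun i => ?_, fun i => ?_⟩
  · rw [(N.isFlow_flow p).2.2 i]
    refine Finset.sum_congr rfl fun k _ => ?_
    by_cases hik : N.graph.Adj i.succ k
    · rw [N.sVar_of_isPhaseOf hv.1 h hik]
    · simp [N.B_zero _ _ hik]
  · rw [← hv.2 i, reducedInjection]
    congr 1
    refine Finset.sum_congr rfl fun k _ => ?_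
    by_cases hik : N.graph.Adj i.succ k
    · rw [N.cVar_of_isPhaseOf hv.1 h hik]; rfl
    · simp [N.B_zero _ _ hik]

/-- Phases with equal sines and cosines along all lines agree modulo `2π`. -/
theorem angle_eq_of_sVar_eq {v : Fin n → ℝ} (hv : ∀ i, 0 < v i) {φ θ : Fin (n + 1) → ℝ}
    (h0 : φ 0 = θ 0) (hs : ∀ i k, N.graph.Adj i k → sVar v φ i k = sVar v θ i k)
    (hc : ∀ i k, N.graph.Adj i k → cVar v φ i k = cVar v θ i k) (i : Fin (n + 1)) :
    (φ i : Real.Angle) = (θ i : Real.Angle) := by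
  refine N.bus_induction (P := fun i => (φ i : Real.Angle) = (θ i : Real.Angle))
    (by rw [h0]) (fun i k hik hk => ?_) i
  have hp := (Real.sqrt_pos.2 (mul_pos (volt_pos hv i.succ) (volt_pos hv k))).ne'
  have h1 := mul_left_cancel₀ hp (hs _ _ hik)
  have h2 := mul_left_cancel₀ hp (hc _ _ hik)
  have h3 := Real.Angle.cos_sin_inj h2 h1
  rw [Real.Angle.coe_sub, Real.Angle.coe_sub, hk] at h3
  exact sub_left_injective h3

/-- The greatest point maximizes each summand separately, which is why the weights do not matter;
injectivity of the logarithm gives uniqueness. -/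
theorem isOptimal_iff {w p q v : Fin n → ℝ} (hw : ∀ i, 0 < w i)
    (h : IsGreatest {u | N.IsFeasible p q u} v) (u : Fin n → ℝ) :
    N.IsOptimal w p q u ↔ u = v := by
  have key : ∀ u, N.IsFeasible p q u → ∀ i, w i * Real.log (u i) ≤ w i * Real.log (v i) :=
    fun u hu i => mul_le_mul_of_nonneg_left (Real.log_le_log (hu.1.pos i) (h.2 hu i)) (hw i).le
  constructor
  · rintro ⟨hu, hmax⟩
    have h1 := (Finset.sum_eq_sum_iff_of_le fun i _ => key u hu i).1
      (le_antisymm (Finset.sum_le_sum fun i _ => key u hu i) (hmax v h.1))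
    funext i
    exact Real.log_injOn_pos (hu.1.pos i) (h.1.1.pos i)
      (mul_left_cancel₀ (hw i).ne' (h1 i (Finset.mem_univ i)))
  · rintro rfl
    exact ⟨h.1, fun u hu => Finset.sum_le_sum fun i _ => key u hu i⟩

end RadialNetwork

/-! ### Symmetric matrices with nonpositive off-diagonal entries. -/

section ZMatrix

open Matrix

variable {ι : Type*} [Fintype ι] [DecidableEq ι] {M : Matrix ι ι ℝ}

/-- A symmetric matrix with nonpositive off-diagonal entries that maps some positive vector to a
positive vector is positive definite. -/
theorem Matrix.posDef_of_offDiag_nonpos (hM : M.IsHermitian) (hZ : ∀ i k, i ≠ k → M i k ≤ 0)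
    {z : ι → ℝ} (hz : ∀ i, 0 < z i) (hMz : ∀ i, 0 < (M *ᵥ z) i) : M.PosDef := by
  refine Matrix.PosDef.of_dotProduct_mulVec_pos hM fun a ha => ?_
  rw [star_trivial]
  have hs : ∀ i k, M k i = M i k := fun i k => by simpa using hM.apply i k
  -- Substitute `a = z * b`. Off the diagonal the coefficients are nonpositive, so replacing `b i *
  -- b k` by the mean of the squares lowers the form; symmetry then collects the row sums `(M *ᵥ z)
  -- i`.
  have hlow : ∑ i, (a i / z i) ^ 2 * z i * (M *ᵥ z) i ≤ a ⬝ᵥ M *ᵥ a := by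
    have e : ∑ i, (a i / z i) ^ 2 * z i * (M *ᵥ z) i =
        ∑ i, ∑ k, M i k * (z i * z k) * (((a i / z i) ^ 2 + (a k / z k) ^ 2) / 2) := by
      have e1 : ∑ i, (a i / z i) ^ 2 * z i * (M *ᵥ z) i =
          ∑ i, ∑ k, M i k * (z i * z k) * (a i / z i) ^ 2 := by
        refine Finset.sum_congr rfl fun i _ => ?_
        rw [mulVec, dotProduct, Finset.mul_sum]
        exact Finset.sum_congr rfl fun k _ => by ring
      have e2 : ∑ i, ∑ k, M i k * (z i * z k) * (a i / z i) ^ 2 =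
          ∑ i, ∑ k, M i k * (z i * z k) * (a k / z k) ^ 2 := by
        rw [Finset.sum_comm]
        refine Finset.sum_congr rfl fun i _ => Finset.sum_congr rfl fun k _ => ?_
        rw [hs]; ring
      have e3 : ∑ i, ∑ k, M i k * (z i * z k) * (((a i / z i) ^ 2 + (a k / z k) ^ 2) / 2) =
          (∑ i, ∑ k, M i k * (z i * z k) * (a i / z i) ^ 2 +
            ∑ i, ∑ k, M i k * (z i * z k) * (a k / z k) ^ 2) / 2 := by
        simp only [← Finset.sum_add_distrib, Finset.sum_div]
        exact Finset.sum_congr rfl fun i _ => Finset.sum_congr rfl fun k _ => by ring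
      rw [e3, ← e2, ← e1]; ring
    rw [e, dotProduct]
    refine Finset.sum_le_sum fun i _ => ?_
    rw [mulVec, dotProduct, Finset.mul_sum]
    refine Finset.sum_le_sum fun k _ => ?_
    have h1 : a i = z i * (a i / z i) := by have := (hz i).ne'; field_simp
    have h2 : a k = z k * (a k / z k) := by have := (hz k).ne'; field_simp
    have e4 : a i * (M i k * a k) = M i k * (z i * z k) * ((a i / z i) * (a k / z k)) := by
      conv_lhs => rw [h1, h2]
      ring
    rw [e4]
    by_cases hik : i = k
    · subst hik
      exact le_of_eq (by ring)
    · refine mul_le_mul_of_nonpos_left ?_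
        (mul_nonpos_of_nonpos_of_nonneg (hZ i k hik) (mul_pos (hz i) (hz k)).le)
      nlinarith [sq_nonneg (a i / z i - a k / z k)]
  refine lt_of_lt_of_le ?_ hlow
  obtain ⟨i, hi⟩ := Function.ne_iff.1 ha
  refine Finset.sum_pos' (fun i _ => ?_) ⟨i, Finset.mem_univ i, ?_⟩
  · have := hz i; have := hMz i; positivity
  · have := hz i; have := hMz i
    have : a i ≠ 0 := hi
    positivity

/-- The inverse of a positive definite matrix with nonpositive off-diagonal entries is
nonnegative. -/
theorem Matrix.PosDef.nonneg_of_mulVec_nonneg (hM : M.PosDef) (hZ : ∀ i k, i ≠ k → M i k ≤ 0)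
    {z : ι → ℝ} (hz : ∀ i, 0 ≤ (M *ᵥ z) i) (i : ι) : 0 ≤ z i := by
  -- The negative part of `z`. It has disjoint support from the positive part `z + y`, so `y ⬝ᵥ M *ᵥ
  -- (z + y) ≤ 0`, whereas `y ⬝ᵥ M *ᵥ z ≥ 0` and `y ⬝ᵥ M *ᵥ y > 0` if `y ≠ 0`.
  set y : ι → ℝ := fun i => max (- z i) 0 with hy
  have hy0 : ∀ i, 0 ≤ y i := fun i => le_max_right _ _
  by_contra! hi
  have hne : y ≠ 0 := fun h => by
    have h1 : y i = 0 := congrFun h i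
    have h2 : -z i ≤ y i := le_max_left _ _
    linarith
  have h1 := hM.dotProduct_mulVec_pos hne
  rw [star_trivial] at h1
  have h2 : 0 ≤ y ⬝ᵥ M *ᵥ z := Finset.sum_nonneg fun i _ => mul_nonneg (hy0 i) (hz i)
  have h3 : y ⬝ᵥ M *ᵥ (z + y) ≤ 0 := by
    refine Finset.sum_nonpos fun i _ => ?_
    rw [mulVec, dotProduct, Finset.mul_sum]
    refine Finset.sum_nonpos fun k _ => ?_
    have hk : 0 ≤ (z + y) k := by
      have : -z k ≤ y k := le_max_left _ _
      simp only [Pi.add_apply]; linarith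
    by_cases hik : i = k
    · subst hik
      have : y i * (z + y) i = 0 := by
        simp only [hy, Pi.add_apply]
        rcases le_total (-z i) 0 with h | h
        · simp [h]
        · simp [h]
      refine le_of_eq ?_
      calc _ = M i i * (y i * (z + y) i) := by ring
        _ = 0 := by rw [this, mul_zero]
    · exact mul_nonpos_of_nonneg_of_nonpos (hy0 i)
        (mul_nonpos_of_nonpos_of_nonneg (hZ i k hik) hk)
  rw [mulVec_add, dotProduct_add] at h3
  linarith

/-- At a zero of a nonnegative vector, a matrix with nonpositive off-diagonal entries produces a
nonpositive value. -/
theorem Matrix.mulVec_nonpos_of_eq_zero (hZ : ∀ i k, i ≠ k → M i k ≤ 0) {z : ι → ℝ}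
    (hz : ∀ i, 0 ≤ z i) {i : ι} (hi : z i = 0) : (M *ᵥ z) i ≤ 0 := by
  refine Finset.sum_nonpos fun k _ => ?_
  by_cases hik : i = k
  · subst hik; simp [hi]
  · exact mul_nonpos_of_nonpos_of_nonneg (hZ i k hik) (hz k)

end ZMatrix

/-! ### The stability matrix and the exact second-order expansion. -/

namespace RadialNetwork

open Matrix

variable {n : ℕ} (N : RadialNetwork n)

/-- The stability matrix as a function of `v` and `c`. -/
noncomputable def couplingMatrix (v : Fin n → ℝ) (c : Fin (n + 1) → Fin (n + 1) → ℝ) :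
    Matrix (Fin n) (Fin n) ℝ :=
  Matrix.diagonal (fun i => 2 * N.totalB i.succ * v i -
      ∑ k, N.B i.succ k * (v i * volt v k) / c i.succ k) -
    Matrix.of fun i k => N.B i.succ k.succ * (v i * v k) / c i.succ k.succ

theorem stabilityMatrix_eq {v : Fin n → ℝ} {θ : Fin (n + 1) → ℝ}
    {c : Fin (n + 1) → Fin (n + 1) → ℝ} (h : ∀ i k, N.graph.Adj i k → cVar v θ i k = c i k) :
    N.stabilityMatrix v θ = N.couplingMatrix v c := by
  have key : ∀ i k x, N.B i k * x / cVar v θ i k = N.B i k * x / c i k := by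
    intro i k x
    by_cases hik : N.graph.Adj i k
    · rw [h i k hik]
    · simp [N.B_zero _ _ hik]
  simp only [stabilityMatrix, couplingMatrix, key]

theorem couplingMatrix_isHermitian {v : Fin n → ℝ} {c : Fin (n + 1) → Fin (n + 1) → ℝ}
    (hc : ∀ i k, c i k = c k i) : (N.couplingMatrix v c).IsHermitian := by
  refine Matrix.IsHermitian.sub (Matrix.isHermitian_diagonal _) ?_
  ext i k
  simp only [Matrix.conjTranspose_apply, Matrix.of_apply, star_trivial]
  rw [N.B_symm, hc, mul_comm (v k)]

theorem couplingMatrix_offDiag (v : Fin n → ℝ) (c : Fin (n + 1) → Fin (n + 1) → ℝ) {i k : Fin n}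
    (h : i ≠ k) :
    N.couplingMatrix v c i k = - (N.B i.succ k.succ * (v i * v k) / c i.succ k.succ) := by
  simp [couplingMatrix, Matrix.diagonal_apply_ne _ h]

theorem couplingMatrix_nonpos {v : Fin n → ℝ} (hv : ∀ i, 0 < v i)
    {c : Fin (n + 1) → Fin (n + 1) → ℝ} (hc : ∀ i k, 0 ≤ c i k) (i k : Fin n) (h : i ≠ k) :
    N.couplingMatrix v c i k ≤ 0 := by
  rw [couplingMatrix_offDiag N v c h]
  have := N.B_nonneg i.succ k.succ
  have := hv i
  have := hv k
  have := hc i.succ k.succ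
  exact neg_nonpos.2 (by positivity)

theorem couplingMatrix_diag (v : Fin n → ℝ) (c : Fin (n + 1) → Fin (n + 1) → ℝ) (i : Fin n) :
    N.couplingMatrix v c i i = 2 * N.totalB i.succ * v i -
      ∑ k, N.B i.succ k * (v i * volt v k) / c i.succ k := by
  have : N.B i.succ i.succ = 0 := N.B_zero _ _ N.graph.irrefl
  simp [couplingMatrix, this]

theorem couplingMatrix_mulVec (v : Fin n → ℝ) (c : Fin (n + 1) → Fin (n + 1) → ℝ) (a : Fin n → ℝ)
    (i : Fin n) : (N.couplingMatrix v c *ᵥ a) i =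
      ∑ k, N.B i.succ k * (2 * v i * a i -
        v i * volt v k / c i.succ k * (a i + (Fin.cons 0 a : Fin (n + 1) → ℝ) k)) := by
  rw [couplingMatrix, Matrix.sub_mulVec, Pi.sub_apply, Matrix.mulVec_diagonal, Matrix.mulVec,
    dotProduct]
  have e : ∑ k : Fin n, N.B i.succ k.succ * (v i * v k) / c i.succ k.succ * a k =
      ∑ k, N.B i.succ k * (v i * volt v k) / c i.succ k *
        (Fin.cons 0 a : Fin (n + 1) → ℝ) k := by
    rw [Fin.sum_univ_succ]; simp
  simp only [Matrix.of_apply]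
  rw [e, sub_mul, Finset.sum_mul, totalB, Finset.mul_sum, Finset.sum_mul, Finset.sum_mul,
    ← Finset.sum_sub_distrib, ← Finset.sum_sub_distrib]
  exact Finset.sum_congr rfl fun k _ => by ring

/-- The relative increase from `u` to `v`. -/
noncomputable def relDiff (u v : Fin n → ℝ) : Fin n → ℝ := fun i => (v i - u i) / u i

/-- The voltage at bus 0 is fixed, so extension by 0 gives the relative increase there too, and
lines to the substation need no separate treatment. -/
theorem mul_relDiff {u : Fin n → ℝ} (hu : ∀ i, 0 < u i) (v : Fin n → ℝ) (k : Fin (n + 1)) :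
    volt u k * (Fin.cons 0 (relDiff u v) : Fin (n + 1) → ℝ) k = volt v k - volt u k := by
  rcases Fin.eq_zero_or_eq_succ k with rfl | ⟨l, rfl⟩
  · simp
  · have := (hu l).ne'
    simp only [volt_succ, Fin.cons_succ, relDiff]
    field_simp

/-- The deviation of the reduced injection from its linearization at `u`. -/
noncomputable def excess (p u v : Fin n → ℝ) (i k : Fin (n + 1)) : ℝ :=
  volt v i * volt u k + volt u i * volt v k -
    2 * (N.flow p i k * N.flow p i k + N.redCos p u i k * N.redCos p v i k)

theorem excess_nonneg {p u v : Fin n → ℝ} (hu : N.IsAdmissible p u) (hv : N.IsAdmissible p v)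
    {i k : Fin (n + 1)} (hik : N.graph.Adj i k) : 0 ≤ N.excess p u v i k := by
  have h1 := hu.redCos_sq hik
  have h2 := hv.redCos_sq hik
  refine sub_nonneg.2 (cone_ineq (volt_pos hu.pos i).le (volt_pos hu.pos k).le
    (volt_pos hv.pos i).le (volt_pos hv.pos k).le ?_ ?_) <;> linarith

/-- Equality in the cone inequality means that `v` and `u` are proportional at the two ends of the
line. This carries equality of two solutions from bus to bus. -/
theorem relDiff_eq_of_excess_eq_zero {p u v : Fin n → ℝ} (hu : N.IsAdmissible p u)
    (hv : N.IsAdmissible p v) {i k : Fin (n + 1)} (hik : N.graph.Adj i k)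
    (h : N.excess p u v i k = 0) :
    (Fin.cons 0 (relDiff u v) : Fin (n + 1) → ℝ) i = (Fin.cons 0 (relDiff u v) : Fin (n + 1) → ℝ) k := by
  have h1 := hu.redCos_sq hik
  have h2 := hv.redCos_sq hik
  have h3 := cone_eq (s := N.flow p i k) (c := N.redCos p u i k) (s' := N.flow p i k)
    (c' := N.redCos p v i k) (volt_pos hu.pos i).le (volt_pos hu.pos k).le
    (volt_pos hv.pos i).le (volt_pos hv.pos k).le (by linarith) (by linarith)
    (sub_nonpos.1 h.le)
  have h4 := mul_relDiff hu.pos v i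
  have h5 := mul_relDiff hu.pos v k
  refine mul_left_cancel₀ (mul_pos (volt_pos hu.pos i) (volt_pos hu.pos k)).ne' ?_
  calc _ = volt u k * (volt v i - volt u i) := by rw [← h4]; ring
    _ = volt u i * (volt v k - volt u k) := by linarith
    _ = _ := by rw [← h5]; ring

/-- Exact second-order expansion of the reduced injection. -/
theorem reducedInjection_sub {p u v : Fin n → ℝ} (hu : N.IsAdmissible p u)
    (hc : ∀ i k, N.graph.Adj i k → 0 < N.redCos p u i k) (i : Fin n) :
    N.reducedInjection p v i - N.reducedInjection p u i =
      (N.couplingMatrix u (N.redCos p u) *ᵥ relDiff u v) i / 2 +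
        ∑ k, N.B i.succ k / (2 * N.redCos p u i.succ k) * N.excess p u v i.succ k := by
  rw [couplingMatrix_mulVec, reducedInjection_eq, reducedInjection_eq, Finset.sum_div,
    ← Finset.sum_sub_distrib, ← Finset.sum_add_distrib]
  refine Finset.sum_congr rfl fun k _ => ?_
  by_cases hik : N.graph.Adj i.succ k
  · have h1 := hu.redCos_sq hik
    have hcp := (hc _ _ hik).ne'
    have h4 := mul_relDiff hu.pos v i.succ
    have h5 := mul_relDiff hu.pos v k
    simp only [Fin.cons_succ, volt_succ] at h4
    rw [volt_succ] at h1
    have e : u i * volt u k / N.redCos p u i.succ k * (relDiff u v i +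
        (Fin.cons 0 (relDiff u v) : Fin (n + 1) → ℝ) k) =
        (volt u k * (v i - u i) + u i * (volt v k - volt u k)) / N.redCos p u i.succ k := by
      rw [← h4, ← h5]; ring
    rw [e, mul_assoc 2, h4, excess, volt_succ, volt_succ]
    field_simp
    -- Both the injection and the excess are affine in `redCos p v`, which cancels; only the cone
    -- equation at `u` is needed, and `v` is arbitrary.
    linear_combination 2 * N.B i.succ k * h1
  · simp [N.B_zero _ _ hik]

theorem relDiff_nonneg {u v : Fin n → ℝ} (hu : ∀ i, 0 < u i) (h : u ≤ v) (i : Fin n) :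
    0 ≤ relDiff u v i := div_nonneg (sub_nonneg.2 (h i)) (hu i).le

/-- A stable solution of the reduced equations is the greatest feasible point. -/
theorem eq_of_posSemidef {p q u v : Fin n → ℝ} (hu : N.IsReducedSolution p q u)
    (hc : ∀ i k, N.graph.Adj i k → 0 < N.redCos p u i k)
    (hM : (N.couplingMatrix u (N.redCos p u)).PosSemidef)
    (hv : IsGreatest {u | N.IsFeasible p q u} v) : u = v := by
  have huv : u ≤ v := hv.2 ⟨hu.1, fun i => (hu.2 i).le⟩
  have hvf : N.IsFeasible p q v := hv.1
  set a := relDiff u v with ha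
  have ha0 : ∀ i, 0 ≤ a i := relDiff_nonneg hu.1.pos huv
  have hE : ∀ i k, 0 ≤ N.B i k / (2 * N.redCos p u i k) * N.excess p u v i k := by
    intro i k
    by_cases hik : N.graph.Adj i k
    · exact mul_nonneg (div_nonneg (N.B_nonneg _ _) (by have := hc _ _ hik; positivity))
        (N.excess_nonneg hu.1 hvf.1 hik)
    · simp [N.B_zero _ _ hik]
  -- The expansion multiplied by `a i ≥ 0`: the injection at `v` is at most `q i`, its value at `u`.
  have h1 : ∀ i, a i * ((N.couplingMatrix u (N.redCos p u) *ᵥ a) i / 2) +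
      a i * ∑ k, N.B i.succ k / (2 * N.redCos p u i.succ k) * N.excess p u v i.succ k ≤ 0 := by
    intro i
    rw [← mul_add, ha, ← N.reducedInjection_sub hu.1 hc]
    exact mul_nonpos_of_nonneg_of_nonpos (ha0 i) (by linarith [hvf.2 i, hu.2 i])
  have h2 := hM.dotProduct_mulVec_nonneg a
  rw [star_trivial] at h2
  have h3 : ∀ i, 0 ≤ a i *
      ∑ k, N.B i.succ k / (2 * N.redCos p u i.succ k) * N.excess p u v i.succ k :=
    fun i => mul_nonneg (ha0 i) (Finset.sum_nonneg fun k _ => hE _ _)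
  have h4 : ∑ i, a i *
      ∑ k, N.B i.succ k / (2 * N.redCos p u i.succ k) * N.excess p u v i.succ k ≤ 0 := by
    have := Finset.sum_nonpos fun i (_ : i ∈ Finset.univ) => h1 i
    rw [Finset.sum_add_distrib] at this
    have e : ∑ i, a i * ((N.couplingMatrix u (N.redCos p u) *ᵥ a) i / 2) =
        (a ⬝ᵥ N.couplingMatrix u (N.redCos p u) *ᵥ a) / 2 := by
      rw [dotProduct, Finset.sum_div]
      exact Finset.sum_congr rfl fun i _ => by ring
    linarith
  have h5 := (Finset.sum_eq_zero_iff_of_nonneg fun i _ => h3 i).1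
    (le_antisymm h4 (Finset.sum_nonneg fun i _ => h3 i))
  -- If `a i ≠ 0`, every remainder term at bus `i` vanishes, so `a i` equals the value at the
  -- preceding bus, which is already 0.
  have h6 : ∀ i, (Fin.cons 0 a : Fin (n + 1) → ℝ) i = 0 := by
    refine N.bus_induction rfl fun i k hik hk => ?_
    rw [Fin.cons_succ]
    rcases mul_eq_zero.1 (h5 i (Finset.mem_univ i)) with h | h
    · exact h
    · have h7 := (Finset.sum_eq_zero_iff_of_nonneg fun k _ => hE i.succ k).1 h k (Finset.mem_univ k)
      have h8 := N.B_pos _ _ hik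
      have h9 := hc _ _ hik
      have h10 := (mul_eq_zero.1 h7).resolve_left (by positivity)
      have h11 := N.relDiff_eq_of_excess_eq_zero hu.1 hvf.1 hik h10
      rw [← ha, hk] at h11
      simpa using h11
  funext i
  have h7 := mul_relDiff hu.1.pos v i.succ
  rw [← ha, h6, mul_zero, volt_succ, volt_succ] at h7
  linarith

/-- Strict stability where the relaxation is strictly feasible. -/
theorem posDef_of_lt {p q q' u v : Fin n → ℝ} (hu : N.IsFeasible p q u) (hq : ∀ i, q i < q' i)
    (hv : IsGreatest {u | N.IsFeasible p q' u} v) :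
    (N.couplingMatrix v (N.redCos p v)).PosDef := by
  have hvr := N.isReducedSolution_of_isGreatest hv
  have hc := N.redCos_pos_of_isGreatest hv
  have huv : u ≤ v := hv.2 ⟨hu.1, fun i => (hu.2 i).trans (hq i).le⟩
  have hZ := N.couplingMatrix_nonpos hvr.1.pos (N.redCos_nonneg p v)
  have hz0 : ∀ i, 0 ≤ (-relDiff v u) i := fun i => by
    rw [Pi.neg_apply, relDiff, ← neg_div, neg_sub]
    exact div_nonneg (sub_nonneg.2 (huv i)) (hvr.1.pos i).le
  -- Expansion at `v` towards `u`: the injection drops strictly, from `q' i` to at most `q i`, while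
  -- the remainder is nonnegative.
  have hMz : ∀ i, 0 < (N.couplingMatrix v (N.redCos p v) *ᵥ (-relDiff v u)) i := by
    intro i
    have h1 := N.reducedInjection_sub (v := u) hvr.1 hc i
    have h2 : 0 ≤ ∑ k, N.B i.succ k / (2 * N.redCos p v i.succ k) * N.excess p v u i.succ k := by
      refine Finset.sum_nonneg fun k _ => ?_
      by_cases hik : N.graph.Adj i.succ k
      · exact mul_nonneg (div_nonneg (N.B_nonneg _ _) (by have := hc _ _ hik; positivity))
          (N.excess_nonneg hvr.1 hu.1 hik)
      · simp [N.B_zero _ _ hik]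
    rw [Matrix.mulVec_neg, Pi.neg_apply]
    linarith [hvr.2 i, hu.2 i, hq i]
  refine Matrix.posDef_of_offDiag_nonpos (N.couplingMatrix_isHermitian (N.redCos_symm p v)) hZ
    (z := -relDiff v u) (fun i => (hz0 i).lt_of_ne fun h => ?_) hMz
  exact (hMz i).not_ge (Matrix.mulVec_nonpos_of_eq_zero hZ hz0 h.symm)

/-- On the domain of convexity the voltages are bounded away from zero, and so are the cosines. -/
theorem exists_lower_bound : ∃ ρ > 0, ∀ p v, N.IsAdmissible p v →
    (∀ i k, N.graph.Adj i k → 0 < N.redCos p v i k) →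
    (N.couplingMatrix v (N.redCos p v)).PosSemidef →
    (∀ i, ρ ≤ v i) ∧ ∀ i k, N.graph.Adj i k → ρ ≤ N.redCos p v i k := by
  -- A semidefinite matrix has nonnegative diagonal, so each single term subtracted in a diagonal
  -- entry is at most `2 * totalB * v i`.
  have diag : ∀ p v, N.IsAdmissible p v →
      (∀ i k, N.graph.Adj i k → 0 < N.redCos p v i k) →
      (N.couplingMatrix v (N.redCos p v)).PosSemidef → ∀ (i : Fin n) k, N.graph.Adj i.succ k →
      N.B i.succ k / (2 * N.totalB i.succ) * volt v k ≤ N.redCos p v i.succ k := by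
    intro p v hv hc hM i k hik
    have h1 : 0 ≤ N.couplingMatrix v (N.redCos p v) i i := hM.diag_nonneg
    rw [couplingMatrix_diag] at h1
    have h2 : N.B i.succ k * (v i * volt v k) / N.redCos p v i.succ k ≤
        ∑ k, N.B i.succ k * (v i * volt v k) / N.redCos p v i.succ k := by
      refine Finset.single_le_sum (f := fun k =>
        N.B i.succ k * (v i * volt v k) / N.redCos p v i.succ k) (fun k _ => ?_) (Finset.mem_univ k)
      exact div_nonneg (mul_nonneg (N.B_nonneg _ _)
        (mul_pos (hv.pos i) (volt_pos hv.pos k)).le) (N.redCos_nonneg _ _ _ _)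
    have h3 := hc _ _ hik
    have h4 : 0 < N.totalB i.succ := (N.B_pos _ _ hik).trans_le
      (Finset.single_le_sum (f := N.B i.succ) (fun k _ => N.B_nonneg _ _) (Finset.mem_univ k))
    have h5 : N.B i.succ k * (v i * volt v k) / N.redCos p v i.succ k ≤
        2 * N.totalB i.succ * v i := by linarith
    rw [div_le_iff₀ h3] at h5
    rw [div_mul_eq_mul_div, div_le_iff₀ (by positivity)]
    refine le_of_mul_le_mul_left ?_ (hv.pos i)
    linarith
  have key : ∀ i, ∃ ρ > 0, ∀ p v, N.IsAdmissible p v →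
      (∀ i k, N.graph.Adj i k → 0 < N.redCos p v i k) →
      (N.couplingMatrix v (N.redCos p v)).PosSemidef → ρ ≤ volt v i := by
    refine N.bus_induction ⟨1, one_pos, fun p v _ _ _ => by simp⟩
      fun i k hik ⟨ρ, hρ, h⟩ => ?_
    have h4 : 0 < N.totalB i.succ := (N.B_pos _ _ hik).trans_le
      (Finset.single_le_sum (f := N.B i.succ) (fun k _ => N.B_nonneg _ _) (Finset.mem_univ k))
    have h5 := N.B_pos _ _ hik
    -- Combine the lower bound on the root with `redCos ^ 2 ≤ v i * volt v k` and cancel one factor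
    -- `volt v k`.
    refine ⟨(N.B i.succ k / (2 * N.totalB i.succ)) ^ 2 * ρ, by positivity,
      fun p v hv hc hM => ?_⟩
    have h6 := diag p v hv hc hM i k hik
    have h7 := h p v hv hc hM
    have h8 := hv.redCos_sq hik
    have h9 := volt_pos hv.pos k
    have h10 := pow_le_pow_left₀ (by positivity) h6 2
    have h11 : (N.B i.succ k / (2 * N.totalB i.succ)) ^ 2 * volt v k ≤ volt v i.succ := by
      refine le_of_mul_le_mul_right ?_ h9
      nlinarith [sq_nonneg (N.flow p i.succ k)]
    exact (mul_le_mul_of_nonneg_left h7 (sq_nonneg _)).trans h11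
  choose ρ hρ h using key
  have edge : ∀ i k, ∃ r > 0, N.graph.Adj i k → ∀ p v, N.IsAdmissible p v →
      (∀ i k, N.graph.Adj i k → 0 < N.redCos p v i k) →
      (N.couplingMatrix v (N.redCos p v)).PosSemidef → r ≤ N.redCos p v i k := by
    intro i k
    by_cases hik : N.graph.Adj i k
    · refine N.line_induction (P := fun i k => ∃ r > 0, N.graph.Adj i k → ∀ p v, N.IsAdmissible p v →
        (∀ i k, N.graph.Adj i k → 0 < N.redCos p v i k) →
        (N.couplingMatrix v (N.redCos p v)).PosSemidef → r ≤ N.redCos p v i k) ?_ ?_ i k hik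
      · rintro i k ⟨r, hr, h⟩
        refine ⟨r, hr, fun hki p v hv hc hM => ?_⟩
        rw [redCos_symm]
        exact h hki.symm p v hv hc hM
      · intro i k hik
        have h4 : 0 < N.totalB i.succ := (N.B_pos _ _ hik).trans_le
          (Finset.single_le_sum (f := N.B i.succ) (fun k _ => N.B_nonneg _ _) (Finset.mem_univ k))
        have h5 := N.B_pos _ _ hik
        refine ⟨N.B i.succ k / (2 * N.totalB i.succ) * ρ k, mul_pos (by positivity) (hρ k),
          fun _ p v hv hc hM => ?_⟩
        exact (mul_le_mul_of_nonneg_left (h k p v hv hc hM) (by positivity)).trans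
          (diag p v hv hc hM i k hik)
    · exact ⟨1, one_pos, fun h => absurd h hik⟩
  choose r hr h' using edge
  obtain ⟨x, -, hx⟩ := Finset.exists_min_image (Finset.univ : Finset (Fin (n + 1))) ρ ⟨0, by simp⟩
  obtain ⟨y, -, hy⟩ := Finset.exists_min_image
    (Finset.univ : Finset (Fin (n + 1) × Fin (n + 1))) (fun y => r y.1 y.2) ⟨(0, 0), by simp⟩
  refine ⟨min (ρ x) (r y.1 y.2), lt_min (hρ x) (hr _ _), fun p v hv hc hM => ⟨fun i => ?_,
    fun i k hik => ?_⟩⟩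
  · exact (min_le_left _ _).trans ((hx i.succ (Finset.mem_univ _)).trans (h i.succ p v hv hc hM))
  · exact (min_le_right _ _).trans ((hy (i, k) (Finset.mem_univ _)).trans (h' i k hik p v hv hc hM))

end RadialNetwork

/-! ### Stability of the greatest point and continuity. -/

namespace RadialNetwork

open Matrix Filter Topology

variable {n : ℕ} (N : RadialNetwork n)

theorem mem_feasibleInjections_of_le {p q q' : Fin n → ℝ} (h : (p, q) ∈ N.feasibleInjections)
    (hq : q ≤ q') : (p, q') ∈ N.feasibleInjections := by
  obtain ⟨u, hu⟩ := h
  exact ⟨u, hu.1, fun i => (hu.2 i).trans (hq i)⟩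

theorem tendsto_redCos {α : Type*} {l : Filter α} {P V : α → Fin n → ℝ} {p v : Fin n → ℝ}
    (hP : Tendsto P l (𝓝 p)) (hV : Tendsto V l (𝓝 v)) (i k : Fin (n + 1)) :
    Tendsto (fun a => N.redCos (P a) (V a) i k) l (𝓝 (N.redCos p v i k)) :=
  ((N.continuous_redCos i k).tendsto (p, v)).comp (hP.prodMk_nhds hV)

theorem tendsto_reducedInjection {α : Type*} {l : Filter α} {P V : α → Fin n → ℝ}
    {p v : Fin n → ℝ} (hP : Tendsto P l (𝓝 p)) (hV : Tendsto V l (𝓝 v)) (i : Fin n) :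
    Tendsto (fun a => N.reducedInjection (P a) (V a) i) l (𝓝 (N.reducedInjection p v i)) :=
  ((N.continuous_reducedInjection i).tendsto (p, v)).comp (hP.prodMk_nhds hV)

/-- The domain of convexity is closed. -/
theorem posSemidef_of_tendsto {α : Type*} {l : Filter α} [l.NeBot] {P V : α → Fin n → ℝ}
    {p v : Fin n → ℝ} (hP : Tendsto P l (𝓝 p)) (hV : Tendsto V l (𝓝 v))
    (hc : ∀ i k, N.graph.Adj i k → 0 < N.redCos p v i k)
    (h : ∀ᶠ a in l, (N.couplingMatrix (V a) (N.redCos (P a) (V a))).PosSemidef) :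
    (N.couplingMatrix v (N.redCos p v)).PosSemidef := by
  have hv : ∀ k, Tendsto (fun a => volt (V a) k) l (𝓝 (volt v k)) :=
    fun k => ((continuous_volt k).tendsto v).comp hV
  have hT : ∀ (i : Fin n) k, Tendsto (fun a => N.B i.succ k * (V a i * volt (V a) k) /
      N.redCos (P a) (V a) i.succ k) l (𝓝 (N.B i.succ k * (v i * volt v k) /
      N.redCos p v i.succ k)) := by
    intro i k
    by_cases hik : N.graph.Adj i.succ k
    · exact (((hv i.succ).mul (hv k)).const_mul _).div (N.tendsto_redCos hP hV _ _) (hc _ _ hik).ne'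
    · simp only [N.B_zero _ _ hik, zero_mul, zero_div]
      exact tendsto_const_nhds
  have hM : Tendsto (fun a => N.couplingMatrix (V a) (N.redCos (P a) (V a))) l
      (𝓝 (N.couplingMatrix v (N.redCos p v))) := by
    refine tendsto_pi_nhds.2 fun i => tendsto_pi_nhds.2 fun k => ?_
    by_cases hik : i = k
    · subst hik
      simp only [couplingMatrix_diag]
      exact ((hv i.succ).const_mul _).sub (tendsto_finsetSum _ fun k _ => hT i k)
    · simp only [couplingMatrix_offDiag N _ _ hik]
      exact (hT i k.succ).neg
  refine Matrix.PosSemidef.of_dotProduct_mulVec_nonneg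
    (N.couplingMatrix_isHermitian (N.redCos_symm p v)) fun x => ?_
  have hcont : Continuous fun M : Matrix (Fin n) (Fin n) ℝ => star x ⬝ᵥ M *ᵥ x := by fun_prop
  exact ge_of_tendsto ((hcont.tendsto _).comp hM)
    (h.mono fun a ha => ha.dotProduct_mulVec_nonneg x)

/-- The greatest feasible point lies in the domain of convexity. -/
theorem posSemidef_of_isGreatest {p q v : Fin n → ℝ}
    (hv : IsGreatest {u | N.IsFeasible p q u} v) :
    (N.couplingMatrix v (N.redCos p v)).PosSemidef := by
  have hvf : N.IsFeasible p q v := hv.1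
  have hS : ∀ ε : ℝ, 0 < ε → (p, q + fun _ => ε) ∈ N.feasibleInjections := fun ε hε =>
    N.mem_feasibleInjections_of_le ⟨v, hvf⟩ fun i => by simpa using hε.le
  -- Greatest points for injections with slack `ε`; the value 0 for `ε ≤ 0` is never used.
  have hex : ∀ ε : ℝ, ∃ w, 0 < ε → IsGreatest {u | N.IsFeasible p (q + fun _ => ε) u} w := by
    intro ε
    by_cases hε : 0 < ε
    · obtain ⟨w, hw⟩ := N.exists_isGreatest (hS ε hε)
      exact ⟨w, fun _ => hw⟩
    · exact ⟨0, fun h => absurd h hε⟩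
  choose w hw using hex
  obtain ⟨R, hR⟩ := N.exists_bound (∑ i, (q i + 1))
  have hle : ∀ ε, 0 < ε → v ≤ w ε := fun ε hε =>
    (hw ε hε).2 ⟨hvf.1, fun i => (hvf.2 i).trans (by simpa using hε.le)⟩
  -- Along an ultrafilter, boundedness alone gives a limit, without passing to subsequences.
  set U : Ultrafilter ℝ := Ultrafilter.of (𝓝[>] (0 : ℝ)) with hU
  have hUle : (U : Filter ℝ) ≤ 𝓝[>] 0 := Ultrafilter.of_le _
  have hpos : ∀ᶠ ε in (U : Filter ℝ), 0 < ε := hUle self_mem_nhdsWithin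
  have hlt1 : ∀ᶠ ε in (U : Filter ℝ), ε < 1 :=
    hUle (mem_nhdsWithin_of_mem_nhds (Iio_mem_nhds one_pos))
  have hU0 : Tendsto (fun ε : ℝ => ε) (U : Filter ℝ) (𝓝 0) := hUle.trans nhdsWithin_le_nhds
  have hK : ∀ᶠ ε in (U : Filter ℝ), w ε ∈ Set.Icc v fun _ => R := by
    filter_upwards [hpos, hlt1] with ε h0 h1
    refine ⟨hle ε h0, fun i => hR p _ (w ε) (hw ε h0).1 ?_ i⟩
    exact Finset.sum_le_sum fun i _ => by simpa using h1.le
  obtain ⟨y, hy, hyU⟩ := isCompact_Icc.ultrafilter_le_nhds' (U.map w) hK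
  have hwy : Tendsto w (U : Filter ℝ) (𝓝 y) := hyU
  have hyf : N.IsFeasible p q y := by
    refine ⟨hvf.1.mono hy.1, fun i => ?_⟩
    refine le_of_tendsto_of_tendsto (N.tendsto_reducedInjection tendsto_const_nhds hwy i)
      (g := fun ε => q i + ε) ?_ ?_
    · simpa using hU0.const_add (q i)
    · filter_upwards [hpos] with ε h0
      exact (hw ε h0).1.2 i
  -- The limit is feasible for `q` itself and lies above `v`, so by maximality it is `v`.
  obtain rfl : y = v := le_antisymm (hv.2 hyf) hy.1
  refine N.posSemidef_of_tendsto tendsto_const_nhds hwy (N.redCos_pos_of_isGreatest hv) ?_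
  filter_upwards [hpos] with ε h0
  exact (N.posDef_of_lt hvf (fun i => by simpa using h0) (hw ε h0)).posSemidef

open Classical in
/-- The greatest feasible point of the relaxation (`0` if the relaxation is infeasible). -/
noncomputable def highVolt (x : (Fin n → ℝ) × (Fin n → ℝ)) : Fin n → ℝ :=
  if h : x ∈ N.feasibleInjections then (N.exists_isGreatest (p := x.1) (q := x.2) h).choose else 0

theorem isGreatest_highVolt {x : (Fin n → ℝ) × (Fin n → ℝ)} (h : x ∈ N.feasibleInjections) :
    IsGreatest {u | N.IsFeasible x.1 x.2 u} (N.highVolt x) := by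
  rw [highVolt, dif_pos h]
  exact (N.exists_isGreatest (p := x.1) (q := x.2) h).choose_spec

/-- Near `x` the greatest points stay in a compact box with roots bounded away from 0. Every cluster
point is thus a stable reduced solution at `x`, and by `eq_of_posSemidef` there is only one. -/
theorem continuousOn_highVolt : ContinuousOn N.highVolt N.feasibleInjections := by
  intro x hx
  obtain ⟨ρ, hρ, hlow⟩ := N.exists_lower_bound
  obtain ⟨R, hR⟩ := N.exists_bound (∑ i, x.2 i + 1)
  have hprop : ∀ x' ∈ N.feasibleInjections,
      (∀ i, ρ ≤ N.highVolt x' i) ∧ ∀ i k, N.graph.Adj i k → ρ ≤ N.redCos x'.1 (N.highVolt x') i k := by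
    intro x' hx'
    have hg := N.isGreatest_highVolt hx'
    exact hlow _ _ hg.1.1 (N.redCos_pos_of_isGreatest hg) (N.posSemidef_of_isGreatest hg)
  have hmem : ∀ᶠ x' in 𝓝[N.feasibleInjections] x, x' ∈ N.feasibleInjections := self_mem_nhdsWithin
  have hsum : ∀ᶠ x' in 𝓝[N.feasibleInjections] x, ∑ i, x'.2 i < ∑ i, x.2 i + 1 := by
    refine mem_nhdsWithin_of_mem_nhds ?_
    have hc : Continuous fun x' : (Fin n → ℝ) × (Fin n → ℝ) => ∑ i, x'.2 i := by fun_prop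
    exact hc.continuousAt.eventually_lt continuousAt_const (lt_add_one _)
  refine (isCompact_Icc (a := fun _ => ρ) (b := fun _ => R)).tendsto_nhds_of_unique_mapClusterPt
    ?_ fun y hy hcl => ?_
  · filter_upwards [hmem, hsum] with x' h1 h2
    exact ⟨(hprop x' h1).1, hR x'.1 x'.2 _ (N.isGreatest_highVolt h1).1 h2.le⟩
  · obtain ⟨U, hU, hUy⟩ := mapClusterPt_iff_ultrafilter.1 hcl
    have hUx : Tendsto (fun x' => x') (U : Filter _) (𝓝 x) := hU.trans nhdsWithin_le_nhds
    have hU1 : Tendsto Prod.fst (U : Filter ((Fin n → ℝ) × (Fin n → ℝ))) (𝓝 x.1) :=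
      (continuous_fst.tendsto x).comp hUx
    have hU2 : Tendsto Prod.snd (U : Filter ((Fin n → ℝ) × (Fin n → ℝ))) (𝓝 x.2) :=
      (continuous_snd.tendsto x).comp hUx
    have hmem' := hU hmem
    have hvt : ∀ k, Tendsto (fun x' => volt (N.highVolt x') k) (U : Filter _) (𝓝 (volt y k)) :=
      fun k => ((continuous_volt k).tendsto y).comp hUy
    have hc : ∀ i k, N.graph.Adj i k → 0 < N.redCos x.1 y i k := by
      intro i k hik
      refine hρ.trans_le (ge_of_tendsto (N.tendsto_redCos hU1 hUy i k) ?_)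
      filter_upwards [hmem'] with x' h
      exact (hprop x' h).2 i k hik
    have hred : N.IsReducedSolution x.1 x.2 y := by
      refine ⟨⟨fun i => hρ.trans_le (hy.1 i), fun i k hik => ?_⟩, fun i => ?_⟩
      · refine le_of_tendsto_of_tendsto
          ((((N.continuous_flow i k).tendsto x.1).comp hU1).pow 2) ((hvt i).mul (hvt k)) ?_
        filter_upwards [hmem'] with x' h
        exact (N.isGreatest_highVolt h).1.1.sq_le i k hik
      · refine tendsto_nhds_unique (N.tendsto_reducedInjection hU1 hUy i)
          ((((continuous_apply i).tendsto x.2).comp hU2).congr' ?_)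
        filter_upwards [hmem'] with x' h
        exact ((N.isReducedSolution_of_isGreatest (N.isGreatest_highVolt h)).2 i).symm
    refine N.eq_of_posSemidef hred hc (N.posSemidef_of_tendsto hU1 hUy hc ?_)
      (N.isGreatest_highVolt hx)
    filter_upwards [hmem'] with x' h
    exact N.posSemidef_of_isGreatest (N.isGreatest_highVolt h)

/-- The phases of the high-voltage solution. -/
noncomputable def highPhase (x : (Fin n → ℝ) × (Fin n → ℝ)) : Fin (n + 1) → ℝ :=
  (N.existsUnique_isPhaseOf x.1 (N.highVolt x)).choose

theorem isPhaseOf_highPhase (x : (Fin n → ℝ) × (Fin n → ℝ)) :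
    N.IsPhaseOf x.1 (N.highVolt x) (N.highPhase x) :=
  (N.existsUnique_isPhaseOf x.1 (N.highVolt x)).choose_spec.1

theorem continuousOn_highPhase : ContinuousOn N.highPhase N.feasibleInjections := by
  refine continuousOn_pi.2 fun i => ?_
  refine N.bus_induction (P := fun i => ContinuousOn (fun x => N.highPhase x i)
    N.feasibleInjections) ?_ (fun i k hik hk => ?_) i
  · exact continuousOn_const.congr fun x _ => (N.isPhaseOf_highPhase x).1
  · have hv : ∀ j, ContinuousOn (fun x => volt (N.highVolt x) j) N.feasibleInjections :=
      fun j => (continuous_volt j).comp_continuousOn N.continuousOn_highVolt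
    have hd : ContinuousOn (fun x : (Fin n → ℝ) × (Fin n → ℝ) => Real.arcsin (N.flow x.1 i.succ k /
        √(volt (N.highVolt x) i.succ * volt (N.highVolt x) k))) N.feasibleInjections := by
      refine Real.continuous_arcsin.comp_continuousOn (ContinuousOn.div ?_ ?_ fun x hx => ?_)
      · exact ((N.continuous_flow i.succ k).comp continuous_fst).continuousOn
      · exact Real.continuous_sqrt.comp_continuousOn ((hv i.succ).mul (hv k))
      · have hp := (N.isGreatest_highVolt hx).1.1.pos
        exact (Real.sqrt_pos.2 (mul_pos (volt_pos hp i.succ) (volt_pos hp k))).ne'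
    refine (hk.add hd).congr fun x _ => ?_
    have h := (N.isPhaseOf_highPhase x).2 _ _ hik
    simp only [Pi.add_apply]
    linarith

end RadialNetwork

/-! ### Differentiability, voltage-regularity and uniqueness. -/

namespace RadialNetwork

open Matrix Filter Topology

variable {n : ℕ} (N : RadialNetwork n)

/-- The derivative of `volt v k` with respect to `v`. -/
noncomputable def voltDeriv (k : Fin (n + 1)) : (Fin n → ℝ) →L[ℝ] ℝ :=
  (Fin.cons 0 (fun i => ContinuousLinearMap.proj i) : Fin (n + 1) → ((Fin n → ℝ) →L[ℝ] ℝ)) k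

theorem voltDeriv_apply (k : Fin (n + 1)) (h : Fin n → ℝ) :
    voltDeriv k h = (Fin.cons 0 h : Fin (n + 1) → ℝ) k := by
  refine Fin.cases ?_ (fun i => ?_) k <;> simp [voltDeriv]

theorem hasFDerivAt_volt (k : Fin (n + 1)) (v : Fin n → ℝ) :
    HasFDerivAt (fun v => volt v k) (voltDeriv k) v := by
  refine Fin.cases ?_ (fun i => ?_) k
  · simpa [voltDeriv] using hasFDerivAt_const (1 : ℝ) v
  · simpa [voltDeriv] using hasFDerivAt_apply i v

/-- The Jacobian of the reduced injections. -/
noncomputable def jacobian (p v : Fin n → ℝ) : (Fin n → ℝ) →ₗ[ℝ] (Fin n → ℝ) :=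
  Matrix.mulVecLin (N.couplingMatrix v (N.redCos p v) * Matrix.diagonal fun i => (2 * v i)⁻¹)

theorem jacobian_apply (p v h : Fin n → ℝ) :
    N.jacobian p v h = N.couplingMatrix v (N.redCos p v) *ᵥ fun i => (2 * v i)⁻¹ * h i := by
  rw [jacobian, Matrix.mulVecLin_apply, ← Matrix.mulVec_mulVec]
  congr 1
  funext i
  rw [Matrix.mulVec_diagonal]

/-- The coupling matrix acts on half the relative changes `h i / (2 * v i)`, which accounts for the
diagonal factor in `jacobian`. Positive roots are what makes the square roots differentiable. -/
theorem hasFDerivAt_reducedInjection {p v : Fin n → ℝ} (hv : N.IsAdmissible p v)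
    (hc : ∀ i k, N.graph.Adj i k → 0 < N.redCos p v i k) :
    HasFDerivAt (N.reducedInjection p) (LinearMap.toContinuousLinearMap (N.jacobian p v)) v := by
  refine hasFDerivAt_pi'.2 fun i => ?_
  simp only [reducedInjection_eq]
  have hterm : ∀ k, HasFDerivAt (fun u : Fin n → ℝ => N.B i.succ k * (u i - N.redCos p u i.succ k))
      (N.B i.succ k • (voltDeriv i.succ - (1 / (2 * N.redCos p v i.succ k)) •
        (volt v i.succ • voltDeriv k + volt v k • voltDeriv i.succ))) v := by
    intro k
    by_cases hik : N.graph.Adj i.succ k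
    · refine ((hasFDerivAt_volt i.succ v).sub (HasFDerivAt.sqrt ?_ ?_)).const_mul _
      · exact ((hasFDerivAt_volt i.succ v).mul (hasFDerivAt_volt k v)).sub_const _
      · exact (Real.sqrt_pos.1 (hc _ _ hik)).ne'
    · simpa [N.B_zero _ _ hik] using hasFDerivAt_const (0 : ℝ) v
  refine (HasFDerivAt.fun_sum fun k _ => hterm k).congr_fderiv ?_
  ext h
  simp only [_root_.sum_apply, _root_.smul_apply,
    _root_.sub_apply, _root_.add_apply, voltDeriv_apply, smul_eq_mul,
    ContinuousLinearMap.comp_apply, ContinuousLinearMap.proj_apply,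
    LinearMap.coe_toContinuousLinearMap']
  rw [jacobian_apply, couplingMatrix_mulVec]
  refine Finset.sum_congr rfl fun k _ => ?_
  by_cases hik : N.graph.Adj i.succ k
  · have h1 := (hv.pos i).ne'
    have h2 := (hc _ _ hik).ne'
    have h3 : volt v k * (Fin.cons 0 (fun i => (2 * v i)⁻¹ * h i) : Fin (n + 1) → ℝ) k =
        (Fin.cons 0 h : Fin (n + 1) → ℝ) k / 2 := by
      rcases Fin.eq_zero_or_eq_succ k with rfl | ⟨l, rfl⟩
      · simp
      · have := (hv.pos l).ne'
        simp only [volt_succ, Fin.cons_succ]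
        field_simp
    have h4 : v i * volt v k / N.redCos p v i.succ k * ((2 * v i)⁻¹ * h i +
        (Fin.cons 0 (fun i => (2 * v i)⁻¹ * h i) : Fin (n + 1) → ℝ) k) =
        (volt v k * h i / 2 + v i * ((Fin.cons 0 h : Fin (n + 1) → ℝ) k / 2)) /
          N.redCos p v i.succ k := by
      rw [← h3]; field_simp
    rw [h4]
    simp only [Fin.cons_succ, volt_succ]
    field_simp
    ring
  · simp [N.B_zero _ _ hik]

theorem IsFeederPositive.nonneg {N : RadialNetwork n} {D : (Fin n → ℝ) →L[ℝ] (Fin n → ℝ)}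
    (hD : N.IsFeederPositive D) (i j : Fin n) : 0 ≤ D (Pi.single j 1) i := by
  by_cases h : N.SameFeeder i j
  · exact ((hD i j).1 h).le
  · exact ((hD i j).2 h).ge

/-- A voltage-regular solution lies in the interior of the domain of convexity. -/
theorem IsVoltageRegular.posDef {N : RadialNetwork n} {p q v : Fin n → ℝ}
    (h : N.IsVoltageRegular p q v) :
    (∀ i k, N.graph.Adj i k → 0 < N.redCos p v i k) ∧
      (N.couplingMatrix v (N.redCos p v)).PosDef := by
  obtain ⟨u, D, rfl, hu, hD, hpos⟩ := h
  have hur : N.IsReducedSolution p q (u q) := hu.self_of_nhds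
  have hc : ∀ i k, N.graph.Adj i k → 0 < N.redCos p (u q) i k := by
    refine N.line_induction (fun i k h => by rwa [redCos_symm]) fun j k hjk => ?_
    refine (N.redCos_nonneg _ _ _ _).lt_of_ne fun h0 => ?_
    set γ : ℝ → Fin n → ℝ := fun t => q + t • Pi.single j 1 with hγ
    have hγ0 : γ 0 = q := by simp [hγ]
    have hγd : HasDerivAt γ (Pi.single j 1) 0 := by
      simpa [hγ] using ((hasDerivAt_id (0 : ℝ)).smul_const (Pi.single j (1 : ℝ))).const_add q
    have hγt : Tendsto γ (𝓝 0) (𝓝 q) := by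
      have := hγd.continuousAt.tendsto
      rwa [hγ0] at this
    have hud : HasDerivAt (fun t => u (γ t)) (D (Pi.single j 1)) 0 :=
      HasFDerivAt.comp_hasDerivAt (0 : ℝ) (by rwa [hγ0]) hγd
    have hvd : ∀ k, HasDerivAt (fun t => volt (u (γ t)) k)
        ((Fin.cons 0 (D (Pi.single j 1)) : Fin (n + 1) → ℝ) k) 0 := fun k => by
      rw [← voltDeriv_apply]
      exact (hasFDerivAt_volt k (u (γ 0))).comp_hasDerivAt (0 : ℝ) hud
    -- Along the curve the product of the voltages stays above the squared flow, with equality at `t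
    -- = 0` if the root vanishes there. Its derivative would then be 0, but feeder positivity makes
    -- it positive.
    have hmin : IsLocalMin (fun t => volt (u (γ t)) j.succ * volt (u (γ t)) k) 0 := by
      filter_upwards [hγt.eventually hu] with t ht
      have h1 := hur.1.redCos_sq hjk
      rw [← h0] at h1
      rw [hγ0]
      linarith [ht.1.sq_le _ _ hjk]
    have h1 := hmin.hasDerivAt_eq_zero ((hvd j.succ).mul (hvd k))
    rw [hγ0, Fin.cons_succ] at h1
    have h2 : 0 < D (Pi.single j 1) j := (hpos j j).1 (SimpleGraph.Reachable.refl _)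
    have h3 : 0 ≤ (Fin.cons 0 (D (Pi.single j 1)) : Fin (n + 1) → ℝ) k := by
      rcases Fin.eq_zero_or_eq_succ k with rfl | ⟨l, rfl⟩
      · simp
      · simpa using hpos.nonneg l j
    have h4 := mul_pos h2 (volt_pos hur.1.pos k)
    have h5 := mul_nonneg (volt_pos hur.1.pos j.succ).le h3
    linarith
  refine ⟨hc, ?_⟩
  have hJ := N.hasFDerivAt_reducedInjection hur.1 hc
  have hid : HasFDerivAt (fun q' => N.reducedInjection p (u q'))
      (ContinuousLinearMap.id ℝ (Fin n → ℝ)) q := by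
    refine (hasFDerivAt_id q).congr_of_eventuallyEq ?_
    filter_upwards [hu] with q' h
    exact funext h.2
  have hcomp := (hJ.comp q hD).unique hid
  -- The Jacobian composed with `D` is the identity. Applied to the all-ones vector, this exhibits a
  -- positive vector that the coupling matrix maps to all ones.
  have h1 := DFunLike.congr_fun hcomp (fun _ => 1)
  simp only [ContinuousLinearMap.comp_apply, LinearMap.coe_toContinuousLinearMap',
    ContinuousLinearMap.id_apply, jacobian_apply] at h1
  refine Matrix.posDef_of_offDiag_nonpos (N.couplingMatrix_isHermitian (N.redCos_symm p (u q)))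
    (N.couplingMatrix_nonpos hur.1.pos (N.redCos_nonneg p (u q))) (fun i => ?_) (fun i => by
      rw [h1]; exact one_pos)
  have hsum : (fun _ => 1 : Fin n → ℝ) = ∑ j, Pi.single j 1 :=
    (Finset.univ_sum_single (fun _ : Fin n => (1 : ℝ))).symm
  have h2 := hur.1.pos i
  refine mul_pos (by positivity) ?_
  rw [hsum, map_sum, Finset.sum_apply]
  exact Finset.sum_pos' (fun j _ => hpos.nonneg i j)
    ⟨i, Finset.mem_univ i, (hpos i i).1 (SimpleGraph.Reachable.refl _)⟩

/-- The columns of the inverse of a positive definite coupling matrix are positive on a feeder and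
vanish elsewhere. -/
theorem feeder_positive_of_mulVec_eq {v : Fin n → ℝ} (hv : ∀ i, 0 < v i)
    {c : Fin (n + 1) → Fin (n + 1) → ℝ} (hc0 : ∀ i k, 0 ≤ c i k)
    (hc : ∀ i k, N.graph.Adj i k → 0 < c i k) (hM : (N.couplingMatrix v c).PosDef)
    {z : Fin n → ℝ} {j : Fin n} (hz : N.couplingMatrix v c *ᵥ z = Pi.single j 1) (i : Fin n) :
    (N.SameFeeder i j → 0 < z i) ∧ (¬ N.SameFeeder i j → z i = 0) := by
  classical
  have hZ := N.couplingMatrix_nonpos hv hc0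
  have hz0 : ∀ i, 0 ≤ z i := hM.nonneg_of_mulVec_nonneg hZ fun i => by
    rw [hz, Pi.single_apply]; split_ifs <;> norm_num
  have hj : z j ≠ 0 := fun h => by
    have := Matrix.mulVec_nonpos_of_eq_zero hZ hz0 h
    rw [hz, Pi.single_eq_same] at this
    linarith
  constructor
  · rintro ⟨w⟩
    -- If `z a = 0`, row `a` is a sum of nonpositive terms with nonnegative value, so all its terms
    -- vanish and `z` is 0 at the neighbours as well; along the walk this would reach `j`.
    have walk : ∀ {a b : Fin n}, (N.graph.comap Fin.succ).Walk a b → z b ≠ 0 → z a ≠ 0 := by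
      intro a b w hb ha
      induction w with
      | nil => exact hb ha
      | @cons a k b hak _ ih =>
        refine ih hb ?_
        have hak' : N.graph.Adj a.succ k.succ := hak
        have hne : a ≠ k := hak.ne
        have hterm : ∀ k ∈ Finset.univ, N.couplingMatrix v c a k * z k ≤ 0 := by
          intro k _
          by_cases h : a = k
          · subst h; simp [ha]
          · exact mul_nonpos_of_nonpos_of_nonneg (hZ a k h) (hz0 k)
        have h1 : ∑ k, N.couplingMatrix v c a k * z k = 0 := by
          refine le_antisymm (Finset.sum_nonpos hterm) ?_
          have h2 : ∑ k, N.couplingMatrix v c a k * z k = (Pi.single j 1 : Fin n → ℝ) a :=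
            congrFun hz a
          rw [h2, Pi.single_apply]; split_ifs <;> norm_num
        have h2 := (Finset.sum_eq_zero_iff_of_nonpos hterm).1 h1 k (Finset.mem_univ k)
        refine (mul_eq_zero.1 h2).resolve_left ?_
        rw [couplingMatrix_offDiag N v c hne]
        have := N.B_pos _ _ hak'
        have := hc _ _ hak'
        have := hv a
        have := hv k
        exact neg_ne_zero.2 (by positivity)
    exact (hz0 i).lt_of_ne (walk w hj).symm
  · intro hi
    -- The part of `z` on the other feeders. The matrix does not couple feeders, so the quadratic
    -- form vanishes at `y`.
    set y : Fin n → ℝ := fun i => if N.SameFeeder i j then 0 else z i with hy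
    have h1 : ∀ i, ¬ N.SameFeeder i j → (N.couplingMatrix v c *ᵥ y) i = 0 := by
      intro i hi
      have e : (N.couplingMatrix v c *ᵥ y) i = (N.couplingMatrix v c *ᵥ z) i := by
        change ∑ k, N.couplingMatrix v c i k * y k = ∑ k, N.couplingMatrix v c i k * z k
        refine Finset.sum_congr rfl fun k _ => ?_
        by_cases hk : N.SameFeeder k j
        · have hik : i ≠ k := fun h => hi (h ▸ hk)
          have hadj : ¬ N.graph.Adj i.succ k.succ := fun h =>
            hi ((SimpleGraph.Adj.reachable (G := N.graph.comap Fin.succ) h).trans hk)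
          rw [couplingMatrix_offDiag N v c hik, N.B_zero _ _ hadj]
          simp
        · simp [hy, hk]
      rw [e, hz, Pi.single_apply, if_neg]
      rintro rfl
      exact hi (SimpleGraph.Reachable.refl _)
    have h2 : y ⬝ᵥ N.couplingMatrix v c *ᵥ y = 0 := by
      refine Finset.sum_eq_zero fun i _ => ?_
      by_cases hi : N.SameFeeder i j
      · simp [hy, hi]
      · rw [h1 i hi, mul_zero]
    have h3 : y = 0 := by
      by_contra hne
      have := hM.dotProduct_mulVec_pos hne
      rw [star_trivial, h2] at this
      exact lt_irrefl _ this
    have h4 := congrFun h3 i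
    simpa [hy, hi] using h4

/-- If bus `0` has just one neighbour, there is only one feeder. -/
theorem sameFeeder_of_existsUnique (h : ∃! k, N.graph.Adj 0 k) (i j : Fin n) :
    N.SameFeeder i j := by
  obtain ⟨k, hk, huniq⟩ := h
  obtain ⟨l, rfl⟩ : ∃ l : Fin n, k = l.succ := by
    rcases Fin.eq_zero_or_eq_succ k with rfl | h
    · exact absurd hk N.graph.irrefl
    · exact h
  have key : ∀ i : Fin (n + 1), ∀ m : Fin n, i = m.succ → N.SameFeeder m l := by
    refine N.bus_induction (fun m h => absurd h.symm (Fin.succ_ne_zero m))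
      fun i k hik ih m hm => ?_
    obtain rfl := Fin.succ_injective _ hm
    rcases Fin.eq_zero_or_eq_succ k with rfl | ⟨r, rfl⟩
    · have := Fin.succ_injective _ (huniq _ hik.symm)
      subst this
      exact SimpleGraph.Reachable.refl _
    · exact (SimpleGraph.Adj.reachable (G := N.graph.comap Fin.succ) hik).trans (ih r rfl)
  exact SimpleGraph.Reachable.trans (key _ i rfl) (key _ j rfl).symm

/-- In the interior of the feasible set the stability matrix is positive definite. -/
theorem posDef_of_mem_interior {x : (Fin n → ℝ) × (Fin n → ℝ)}
    (hx : x ∈ interior N.feasibleInjections) :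
    (N.couplingMatrix (N.highVolt x) (N.redCos x.1 (N.highVolt x))).PosDef := by
  -- An interior point leaves room to lower all `q i` by some `ε > 0`, which gives strict
  -- feasibility.
  have hc : Tendsto (fun ε : ℝ => (x.1, x.2 - fun _ => ε)) (𝓝[>] 0) (𝓝 x) := by
    have : Continuous fun ε : ℝ => (x.1, x.2 - fun _ => ε) := by fun_prop
    have h := this.tendsto 0
    have e : (x.1, x.2 - fun _ : Fin n => (0 : ℝ)) = x := by
      ext i <;> simp
    rw [e] at h
    exact h.mono_left nhdsWithin_le_nhds
  obtain ⟨ε, ⟨u, hu⟩, hε⟩ :=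
    ((hc.eventually (mem_interior_iff_mem_nhds.1 hx)).and self_mem_nhdsWithin).exists
  refine N.posDef_of_lt hu (fun i => ?_) (N.isGreatest_highVolt (interior_subset hx))
  simpa using hε

/-- In the interior of the feasible set the high-voltage solution depends differentiably on `q`,
with a Jacobian that is positive on feeders. -/
theorem exists_hasFDerivAt_highVolt {x : (Fin n → ℝ) × (Fin n → ℝ)}
    (hx : x ∈ interior N.feasibleInjections) :
    (∀ᶠ q' in 𝓝 x.2, N.IsReducedSolution x.1 q' (N.highVolt (x.1, q'))) ∧
      ∃ D : (Fin n → ℝ) →L[ℝ] (Fin n → ℝ),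
        HasFDerivAt (fun q => N.highVolt (x.1, q)) D x.2 ∧ N.IsFeederPositive D := by
  have hx' := mem_interior_iff_mem_nhds.1 hx
  have hg := N.isGreatest_highVolt (interior_subset hx)
  have hr := N.isReducedSolution_of_isGreatest hg
  have hc := N.redCos_pos_of_isGreatest hg
  have hM := N.posDef_of_mem_interior hx
  have hpair : Tendsto (fun q' => (x.1, q')) (𝓝 x.2) (𝓝 x) :=
    (Continuous.prodMk_right x.1).tendsto x.2
  have hev : ∀ᶠ q' in 𝓝 x.2, N.IsReducedSolution x.1 q' (N.highVolt (x.1, q')) := by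
    filter_upwards [hpair hx'] with q' h
    exact N.isReducedSolution_of_isGreatest (N.isGreatest_highVolt h)
  refine ⟨hev, ?_⟩
  have hcont : ContinuousAt (fun q => N.highVolt (x.1, q)) x.2 :=
    ((N.continuousOn_highVolt.continuousAt hx').tendsto).comp hpair
  have hinj : Function.Injective (N.jacobian x.1 (N.highVolt x)) := by
    intro a b hab
    rw [jacobian_apply, jacobian_apply] at hab
    have h := Matrix.mulVec_injective_iff_isUnit.2 hM.isUnit hab
    funext i
    have hp := hr.1.pos i
    exact mul_left_cancel₀ (by positivity : (2 * N.highVolt x i)⁻¹ ≠ 0) (congrFun h i)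
  set e := (LinearEquiv.ofInjectiveEndo _ hinj).toContinuousLinearEquiv with he
  have hJ : HasFDerivAt (N.reducedInjection x.1) (e : (Fin n → ℝ) →L[ℝ] (Fin n → ℝ))
      (N.highVolt (x.1, x.2)) := by
    refine (N.hasFDerivAt_reducedInjection hr.1 hc).congr_fderiv ?_
    ext1 a
    rfl
  -- The branch is already known to be continuous and to be inverted by the reduced injections, so
  -- invertibility of their derivative suffices.
  refine ⟨e.symm, HasFDerivAt.of_local_left_inverse hcont hJ ?_, fun i j => ?_⟩
  · filter_upwards [hev] with q' h
    exact funext h.2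
  · set d := e.symm (Pi.single j 1) with hd
    have h1 : e d = Pi.single j 1 := e.apply_symm_apply _
    have h2 : N.jacobian x.1 (N.highVolt x) d = Pi.single j 1 := h1
    rw [jacobian_apply] at h2
    have h3 := N.feeder_positive_of_mulVec_eq hr.1.pos (N.redCos_nonneg _ _) hc hM h2 i
    have hp : 0 < (2 * N.highVolt x i)⁻¹ := by have := hr.1.pos i; positivity
    exact ⟨fun h => pos_of_mul_pos_right (h3.1 h) hp.le,
      fun h => (mul_eq_zero.1 (h3.2 h)).resolve_left hp.ne'⟩

/-- A power flow solution whose voltages are those of the high-voltage solution has the same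
phases modulo `2π`. -/
theorem angle_eq_highPhase {x : (Fin n → ℝ) × (Fin n → ℝ)} (hx : x ∈ N.feasibleInjections)
    {φ : Fin (n + 1) → ℝ} (h : N.IsPolarSolution x.1 x.2 (N.highVolt x) φ) (i : Fin (n + 1)) :
    (φ i : Real.Angle) = (N.highPhase x i : Real.Angle) := by
  have hr := N.isReducedSolution_of_isGreatest (N.isGreatest_highVolt hx)
  have hθ := N.isPhaseOf_highPhase x
  refine N.angle_eq_of_sVar_eq h.pos (h.ref.trans hθ.1.symm) (fun i k hik => ?_)
    (fun i k hik => ?_) i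
  · rw [N.sVar_of_isPhaseOf hr.1 hθ hik, h.flow_eq hik]
  · rw [N.cVar_of_isPhaseOf hr.1 hθ hik, h.isSolution.eq_redCos hr i k hik]

/-- A high-voltage, stable or voltage-regular solution has the voltages of the greatest feasible
point. -/
theorem eq_of_isHighVoltage_or {p q u v : Fin n → ℝ} {φ : Fin (n + 1) → ℝ}
    (hv : IsGreatest {u | N.IsFeasible p q u} v) (hu : N.IsPolarSolution p q u φ)
    (h : N.IsHighVoltage p q u ∨ N.IsStable p q u φ ∨ N.IsVoltageRegular p q u) : u = v := by
  have huf := hu.isSolution.isFeasible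
  rcases h with h | h | h
  · exact le_antisymm (hv.2 huf) (h v (N.isReducedSolution_of_isGreatest hv))
  · obtain ⟨hc, hM⟩ := (N.isStable_iff p q u hu.pos φ).1 h
    -- Stability makes the cosines positive, so they are the nonnegative roots and `u` solves the
    -- reduced equations.
    have hcos : ∀ i k, N.graph.Adj i k → cVar u φ i k = N.redCos p u i k := fun i k hik => by
      rw [hu.isSolution.redCos_eq hik, abs_of_pos (hc i k hik)]
    rw [N.stabilityMatrix_eq hcos] at hM
    refine N.eq_of_posSemidef ⟨huf.1, fun i => ?_⟩ (fun i k hik => ?_) hM hv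
    · rw [← hu.isSolution.reactive' i, reducedInjection_eq]
      refine Finset.sum_congr rfl fun k _ => ?_
      by_cases hik : N.graph.Adj i.succ k
      · rw [hcos _ _ hik]
      · simp [N.B_zero _ _ hik]
    · rw [← hcos i k hik]
      exact hc i k hik
  · obtain ⟨hc, hM⟩ := h.posDef
    obtain ⟨w, D, rfl, hw, -⟩ := h
    exact N.eq_of_posSemidef hw.self_of_nhds hc hM.posSemidef hv

end RadialNetwork

theorem theorem3 (n : ℕ) (N : RadialNetwork n) :
    ∃ (v : (Fin n → ℝ) × (Fin n → ℝ) → (Fin n → ℝ))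
      (θ : (Fin n → ℝ) × (Fin n → ℝ) → (Fin (n + 1) → ℝ)),
      -- on the feasible set, `v` is the unique optimizer (for all weights) and `θ` its phases
      (∀ x ∈ N.feasibleInjections,
        (∀ w : Fin n → ℝ, (∀ i, 0 < w i) → ∀ u, N.IsOptimal w x.1 x.2 u ↔ u = v x) ∧
        ∀ φ, N.IsPhaseOf x.1 (v x) φ ↔ φ = θ x) ∧
      -- convexity and continuity
      (Convex ℝ N.feasibleInjections ∧
        ContinuousOn (fun x => (v x, θ x)) N.feasibleInjections) ∧
      -- no solutions outside the feasible set
      (∀ x ∉ N.feasibleInjections,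
        (¬ ∃ u c, N.IsSolution x.1 x.2 u c) ∧ ¬ ∃ u φ, N.IsPolarSolution x.1 x.2 u φ) ∧
      -- properties of the computed solution
      ∀ x ∈ N.feasibleInjections,
        (N.IsPolarSolution x.1 x.2 (v x) (θ x) ∧ N.IsReducedSolution x.1 x.2 (v x)) ∧
        -- high-voltage
        (N.IsHighVoltage x.1 x.2 (v x) ∧ ∀ u c, N.IsSolution x.1 x.2 u c → u ≤ v x) ∧
        -- stable
        (N.IsStable x.1 x.2 (v x) (θ x) ∧
          (∀ i k, N.graph.Adj i k → 0 < RadialNetwork.cVar (v x) (θ x) i k) ∧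
          (N.stabilityMatrix (v x) (θ x)).PosSemidef) ∧
        -- voltage-regular, and strictly stable, wherever `v` is defined on a neighbourhood
        (x ∈ interior N.feasibleInjections →
          (N.stabilityMatrix (v x) (θ x)).PosDef ∧
          N.IsVoltageRegular x.1 x.2 (v x) ∧
          ∃ D : (Fin n → ℝ) →L[ℝ] (Fin n → ℝ),
            HasFDerivAt (fun q => v (x.1, q)) D x.2 ∧ N.IsFeederPositive D ∧
              ((∃! k, N.graph.Adj 0 k) → ∀ i j, 0 < D (Pi.single j 1) i)) ∧
        -- uniqueness, the phases being determined modulo `2π`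
        ∀ u φ, N.IsPolarSolution x.1 x.2 u φ →
          (N.IsHighVoltage x.1 x.2 u ∨ N.IsStable x.1 x.2 u φ ∨ N.IsVoltageRegular x.1 x.2 u) →
          u = v x ∧ ∀ i, (φ i : Real.Angle) = (θ x i : Real.Angle) := by

  refine ⟨N.highVolt, N.highPhase, fun x hx => ⟨fun w hw u => ?_, fun φ => ?_⟩,
    ⟨N.convex_feasibleInjections, N.continuousOn_highVolt.prodMk N.continuousOn_highPhase⟩,
    fun x hx => ⟨?_, ?_⟩, fun x hx => ?_⟩
  · exact N.isOptimal_iff hw (N.isGreatest_highVolt hx) u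
  · exact ⟨fun h => (N.existsUnique_isPhaseOf _ _).unique h (N.isPhaseOf_highPhase x),
      fun h => h ▸ N.isPhaseOf_highPhase x⟩
  · rintro ⟨u, c, h⟩
    exact hx ⟨u, h.isFeasible⟩
  · rintro ⟨u, φ, h⟩
    exact hx ⟨u, h.isSolution.isFeasible⟩
  have hg := N.isGreatest_highVolt hx
  have hr := N.isReducedSolution_of_isGreatest hg
  have hθ := N.isPhaseOf_highPhase x
  have hcos := fun i k (hik : N.graph.Adj i k) => N.cVar_of_isPhaseOf hr.1 hθ hik
  have hM := N.stabilityMatrix_eq hcos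
  have hc : ∀ i k, N.graph.Adj i k →
      0 < RadialNetwork.cVar (N.highVolt x) (N.highPhase x) i k := fun i k hik => by
    rw [hcos i k hik]
    exact N.redCos_pos_of_isGreatest hg i k hik
  have hpsd : (N.stabilityMatrix (N.highVolt x) (N.highPhase x)).PosSemidef := by
    rw [hM]
    exact N.posSemidef_of_isGreatest hg
  refine ⟨⟨N.isPolarSolution_of_isPhaseOf hr hθ, hr⟩,
    ⟨fun u hu => hg.2 ⟨hu.1, fun i => (hu.2 i).le⟩, fun u c h => hg.2 h.isFeasible⟩,
    ⟨(N.isStable_iff _ _ _ hr.1.pos _).2 ⟨hc, hpsd⟩, hc, hpsd⟩, fun hint => ?_,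
    fun u φ hu h => ?_⟩
  · obtain ⟨hev, D, hD, hpos⟩ := N.exists_hasFDerivAt_highVolt hint
    refine ⟨hM ▸ N.posDef_of_mem_interior hint, ⟨fun q => N.highVolt (x.1, q), D, rfl, hev, hD, hpos⟩,
      D, hD, hpos, fun h i j => (hpos i j).1 (N.sameFeeder_of_existsUnique h i j)⟩
  · obtain rfl := N.eq_of_isHighVoltage_or hg hu h
    exact ⟨rfl, N.angle_eq_highPhase hx hu⟩
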